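/- Let $\mathbf{k}$ be a field and $K=\mathbf{k}(q)$ the field of rational functions. *Algebra.* Let $\mathcal{P}$ be the $K$-vector space with basis the isomorphism classes $[P]$ of finite posets, graded by the number of elements, with product $[P]\cdot[Q]=[P\sqcup Q]$, unit $[\emptyset]$, coproduct $\Delta[P]=\sum_{S\lhd P}[P|_S]\otimes[P|_{P\setminus S}]$ over the ideals (lower sets) $S$ of $P$, and counit sending $[\emptyset]$ to $1$ and all other classes to $0$. For a poset $P$ with $n$ elements and $c(P)$ connected components put $\mathrm{rk}(P)=n-c(P)$ and $\zeta_q([P])=q^{\mathrm{rk}(P)}$, extended linearly. Let $\mathcal{Q}Sym\subset K[[x_1,x_2,\ldots]]$ be the algebra of quasisymmetric functions, with basis $M_\alpha=\sum_{i_1<\cdots<i_k}x_{i_1}^{\alpha_1}\cdots x_{i_k}^{\alpha_k}$ indexed by the compositions $\alpha=(\alpha_1,\ldots,\alpha_k)$ (including the empty one), graded by $|\alpha|$, with coproduct $\Delta M_\alpha=\sum_{\alpha=\beta\gamma}M_\beta\otimes M_\gamma$ (deconcatenation), counit sending $M_{()}=1$ to $1$ and the other $M_\alpha$ to $0$, and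 linear functional $\zeta_{\mathcal{Q}}(M_\alpha)=1$ if $\alpha$ has at most one part and $0$ otherwise. *Geometry.* For a finite poset $P$ on $[n]=\{1,\ldots,n\}$, $n\ge 0$, let $C(P)=\mathrm{cone}\{e_i-e_j : i<_P j\}\subseteq\mathbb{R}^n$. For a nonempty face $G$ of $C(P)$ let $C_G=\{w\in\mathbb{R}^n:\langle w,y\rangle\le\langle w,x\rangle\text{ for all }x\in G,\ y\in C(P)\}$ be its normal cone, $C_G^\circ$ the relative interior of $C_G$, and $$F_q(C(P))=\sum_{G}q^{\dim G}\sum_{\omega\in\mathbb{Z}_{>0}^n\cap C_G^\circ}x_{\omega_1}\cdots x_{\omega_n},$$ the outer sum being over the nonempty faces $G$ of $C(P)$, with $C(P)$ included. **Theorem.** There is exactly one $K$-linear map $\Psi_q:\mathcal{P}\to\mathcal{Q}Sym$ that is a degree-preserving morphism of bialgebras and satisfies $\zeta_{\mathcal{Q}}\circ\Psi_q=\zeta_q$ (the universal morphism of combinatorial Hopf algebras). For every finite poset $P$, the cone $C(P)$ has finitely many faces, and $$F_q(C(P))=\Psi_q([P]).$$ Equivalently, $$F_q(C(P))=\sum_{\mathcal{F}}q^{\mathrm{rk}_P(\mathcal{F})}M_{\mathrm{type}(\mathcal{F})},$$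 where the sum is over all flags $\mathcal{F}:\emptyset=F_0\subsetneq F_1\subsetneq\cdots\subsetneq F_k=P$ of ideals of $P$, with $\mathrm{rk}_P(\mathcal{F})=\sum_{j=1}^k\mathrm{rk}(P|_{F_j\setminus F_{j-1}})$ and $\mathrm{type}(\mathcal{F})=(|F_1\setminus F_0|,\ldots,|F_k\setminus F_{k-1}|)$. -/

import Mathlib

universe u v

namespace PosetQSym

open scoped TensorProduct

/-! ## Finite posets up to isomorphism -/

/-- Two finite posets are equivalent if they are isomorphic as ordered sets. -/
instance isoSetoid : Setoid FinPartOrd.{u} where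
  r P Q := Nonempty (P ≃o Q)
  iseqv :=
    { refl := fun P => ⟨OrderIso.refl P⟩
      symm := fun ⟨e⟩ => ⟨e.symm⟩
      trans := fun ⟨e⟩ ⟨f⟩ => ⟨e.trans f⟩ }

/-- Isomorphism classes of finite posets. -/
def PosetClass : Type (u + 1) := Quotient isoSetoid.{u}

/-- The isomorphism class of a finite poset. -/
def cls (P : Type u) [PartialOrder P] [Fintype P] : PosetClass.{u} :=
  Quotient.mk _ (FinPartOrd.of P)

lemma cls_eq {P Q : Type u} [PartialOrder P] [Fintype P] [PartialOrder Q] [Fintype Q]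
    (e : P ≃o Q) : cls P = cls Q := Quotient.sound ⟨e⟩

namespace PosetClass

/-- Multiplication is disjoint union: `P ⊕ Q` carries the order in which elements of different
summands are incomparable. The unit is the class of the empty poset. -/
noncomputable instance : CommMonoid PosetClass.{u} where
  mul := Quotient.map₂ (fun P Q => FinPartOrd.of (P ⊕ Q))
    (fun _ _ ⟨e⟩ _ _ ⟨f⟩ => ⟨OrderIso.sumCongr e f⟩)
  one := cls PEmpty
  mul_assoc := by
    rintro ⟨P⟩ ⟨Q⟩ ⟨R⟩
    exact Quotient.sound ⟨OrderIso.sumAssoc P Q R⟩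
  mul_comm := by
    rintro ⟨P⟩ ⟨Q⟩
    exact Quotient.sound ⟨OrderIso.sumComm P Q⟩
  one_mul := by
    rintro ⟨P⟩
    refine Quotient.sound ⟨⟨Equiv.emptySum PEmpty P, ?_⟩⟩
    rintro (a | a) (b | b)
    · exact a.elim
    · exact a.elim
    · exact b.elim
    · exact Sum.inr_le_inr_iff.symm
  mul_one := by
    rintro ⟨P⟩
    refine Quotient.sound ⟨⟨Equiv.sumEmpty P PEmpty, ?_⟩⟩
    rintro (a | a) (b | b)
    · exact Sum.inl_le_inl_iff.symm
    · exact b.elim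
    · exact a.elim
    · exact a.elim

end PosetClass

/-- The comparability graph of a poset. -/
def comparabilityGraph (P : Type u) [PartialOrder P] : SimpleGraph P :=
  SimpleGraph.fromRel (fun a b : P => a < b)

/-- `c(P)`, the number of connected components of a poset. -/
noncomputable def numComponents (P : Type u) [PartialOrder P] : ℕ :=
  Nat.card (comparabilityGraph P).ConnectedComponent

/-- `rk(P) = |P| - c(P)`; the subtraction never truncates, as every component is nonempty. -/
noncomputable def posetRank (P : Type u) [PartialOrder P] : ℕ :=
  Nat.card P - numComponents P

lemma posetRank_congr {P Q : Type u} [PartialOrder P] [PartialOrder Q] (e : P ≃o Q) :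
    posetRank P = posetRank Q := by
  have g : comparabilityGraph P ≃g comparabilityGraph Q :=
    ⟨e.toEquiv, by intro a b; simp [comparabilityGraph]⟩
  rw [posetRank, posetRank, numComponents, numComponents, Nat.card_congr e.toEquiv,
    Nat.card_congr g.connectedComponentEquiv]

/-! ## The Hopf algebra of posets -/

/-- The vector space with basis the isomorphism classes of finite posets. As an algebra it is the
monoid algebra of the monoid of classes under disjoint union. (It is a new type because its
coproduct is not the group-like coproduct which Mathlib puts on monoid algebras.) -/
def PosetAlg (K : Type v) [Field K] : Type (max v (u + 1)) := MonoidAlgebra K PosetClass.{u}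

section PosetAlg

variable (K : Type v) [Field K]

noncomputable instance : CommRing (PosetAlg.{u} K) :=
  inferInstanceAs (CommRing (MonoidAlgebra K PosetClass.{u}))

noncomputable instance : Algebra K (PosetAlg.{u} K) :=
  inferInstanceAs (Algebra K (MonoidAlgebra K PosetClass.{u}))

/-- The basis of isomorphism classes. -/
noncomputable def posetBasis : Module.Basis PosetClass.{u} K (PosetAlg.{u} K) :=
  MonoidAlgebra.basis PosetClass.{u} K

/-- The element `[P]` of the algebra of posets. -/
noncomputable def posetElt (P : Type u) [PartialOrder P] [Fintype P] : PosetAlg.{u} K :=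
  posetBasis K (cls P)

open Classical in
/-- The coproduct `Δ[P] = ∑ [P|_S] ⊗ [P|_{P ∖ S}]` of a poset, over all ideals `S` of `P`: no
element outside an ideal is less than an element of it, that is, ideals are lower sets. -/
noncomputable def comulPoset (P : Type u) [PartialOrder P] [Fintype P] :
    PosetAlg.{u} K ⊗[K] PosetAlg.{u} K :=
  ∑ S : LowerSet P,
    posetElt K (S : Set P) ⊗ₜ[K] posetElt K ((S : Set P)ᶜ : Set P)

lemma comulPoset_congr {P Q : Type u} [PartialOrder P] [Fintype P] [PartialOrder Q] [Fintype Q]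
    (e : P ≃o Q) : comulPoset K P = comulPoset K Q := by
  classical
  refine Fintype.sum_equiv (LowerSet.map e).toEquiv _ _ (fun S => ?_)
  have h : ∀ (A : Set P) (B : Set Q), (∀ x, x ∈ A ↔ e x ∈ B) → Nonempty (A ≃o B) := fun A B hAB =>
    ⟨⟨e.toEquiv.subtypeEquiv hAB, by intro a b; exact e.le_iff_le⟩⟩
  obtain ⟨e₁⟩ := h (S : Set P) ((LowerSet.map e S : LowerSet Q) : Set Q) (by intro x; simp)
  obtain ⟨e₂⟩ := h ((S : Set P)ᶜ) (((LowerSet.map e S : LowerSet Q) : Set Q)ᶜ) (by intro x; simp)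
  have h₁ : posetElt K (S : Set P) = posetElt K ((LowerSet.map e S : LowerSet Q) : Set Q) :=
    congrArg (posetBasis K) (cls_eq e₁)
  have h₂ : posetElt K ((S : Set P)ᶜ : Set P)
      = posetElt K (((LowerSet.map e S : LowerSet Q) : Set Q)ᶜ : Set Q) :=
    congrArg (posetBasis K) (cls_eq e₂)
  exact congrArg₂ (fun a b => a ⊗ₜ[K] b) h₁ h₂

open Classical in
/-- Coproduct and counit of the algebra of posets; the counit sends `[∅]` to `1` and every other
class to `0`. -/
noncomputable instance : CoalgebraStruct K (PosetAlg.{u} K) where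
  comul := (posetBasis K).constr K
    (Quotient.lift (fun P : FinPartOrd.{u} => comulPoset K P) fun _ _ ⟨e⟩ => comulPoset_congr K e)
  counit := (posetBasis K).constr K (fun p => if p = 1 then 1 else 0)

/-- The homogeneous component spanned by the posets with `n` elements. -/
noncomputable def posetDegree (n : ℕ) : Submodule K (PosetAlg.{u} K) :=
  Submodule.span K {x | ∃ P : FinPartOrd.{u}, Nat.card P = n ∧ x = posetElt K P}

/-- The character `ζ_q` with `ζ_q([P]) = q ^ rk(P)`. -/
noncomputable def zetaPoset (q : K) : PosetAlg.{u} K →ₗ[K] K :=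
  (posetBasis K).constr K
    (Quotient.lift (fun P : FinPartOrd.{u} => q ^ posetRank P)
      fun _ _ ⟨e⟩ => congrArg (q ^ ·) (posetRank_congr e))

end PosetAlg

/-! ## Quasisymmetric functions -/

/-- The formal sum `∑_{a ∈ A} x^{e a}` of monomials in the variables `x₁, x₂, …`, for a family of
exponents in which every monomial occurs finitely often. -/
noncomputable def formalSum (K : Type v) [Field K] {A : Type*} (e : A → (ℕ+ →₀ ℕ)) :
    MvPowerSeries ℕ+ K :=
  fun m => (Nat.card {a : A // e a = m} : K)

/-- The exponent of the monomial `x_{i_1}^{α_1} ⋯ x_{i_k}^{α_k}`. -/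
noncomputable def expVec (α : List ℕ+) (i : Fin α.length → ℕ+) : ℕ+ →₀ ℕ :=
  ∑ j, Finsupp.single (i j) (α.get j : ℕ)

/-- The monomial quasisymmetric function
`M_α = ∑_{i_1 < ⋯ < i_k} x_{i_1}^{α_1} ⋯ x_{i_k}^{α_k}` of a composition `α`. -/
noncomputable def monomialQSym (K : Type v) [Field K] (α : List ℕ+) : MvPowerSeries ℕ+ K :=
  formalSum K (fun i : Fin α.length ↪o ℕ+ => expVec α i)

section QSym

lemma expVec_apply (α : List ℕ+) (i : Fin α.length ↪o ℕ+) (j : Fin α.length) :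
    expVec α i (i j) = (α.get j : ℕ) := by
  classical
  rw [expVec, Finsupp.finsetSum_apply, Finset.sum_eq_single j]
  · simp
  · intro b _ hb
    exact Finsupp.single_eq_of_ne (by simpa using hb.symm)
  · simp

lemma mem_support_expVec (α : List ℕ+) (i : Fin α.length ↪o ℕ+) (x : ℕ+) :
    x ∈ (expVec α i).support ↔ ∃ j, i j = x := by
  classical
  constructor
  · intro hx
    by_contra! h
    refine (Finsupp.mem_support_iff.1 hx) ?_
    rw [expVec, Finsupp.finsetSum_apply]
    exact Finset.sum_eq_zero fun j _ => Finsupp.single_eq_of_ne (h j).symm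
  · rintro ⟨j, rfl⟩
    rw [Finsupp.mem_support_iff, expVec_apply]
    exact (α.get j).ne_zero

lemma card_support_expVec (α : List ℕ+) (i : Fin α.length ↪o ℕ+) :
    (expVec α i).support.card = α.length := by
  classical
  have : (expVec α i).support = Finset.univ.image i := by
    ext x; rw [mem_support_expVec]; simp
  rw [this, Finset.card_image_of_injective _ i.injective, Finset.card_univ, Fintype.card_fin]

lemma expVec_left_inj {α β : List ℕ+} {i : Fin α.length ↪o ℕ+} {j : Fin β.length ↪o ℕ+}
    (h : expVec α i = expVec β j) : α = β := by
  have hl : α.length = β.length := by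
    rw [← card_support_expVec α i, h, card_support_expVec]
  refine List.ext_get hl fun n h₁ h₂ => ?_
  have hi : ∀ x, i x = (expVec α i).support.orderEmbOfFin (card_support_expVec α i) x := fun x => by
    rw [← Finset.orderEmbOfFin_unique' (card_support_expVec α i) (f := i)]
    exact fun x => (mem_support_expVec α i _).2 ⟨x, rfl⟩
  have hj : (Fin.castOrderIso hl).toOrderEmbedding.trans j =
      (expVec α i).support.orderEmbOfFin (card_support_expVec α i) :=
    Finset.orderEmbOfFin_unique' _ fun x => by
      rw [h]; exact (mem_support_expVec β j _).2 ⟨_, rfl⟩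
  have e : i ⟨n, h₁⟩ = j ⟨n, h₂⟩ := by
    rw [hi, ← hj]; rfl
  have := expVec_apply α i ⟨n, h₁⟩
  rw [e, h, expVec_apply] at this
  exact PNat.coe_injective this.symm

lemma expVec_right_inj {α : List ℕ+} {i j : Fin α.length ↪o ℕ+}
    (h : expVec α i = expVec α j) : i = j := by
  rw [Finset.orderEmbOfFin_unique' (card_support_expVec α i) (f := i)
      (fun x => (mem_support_expVec α i _).2 ⟨x, rfl⟩)]
  exact (Finset.orderEmbOfFin_unique' _ fun x => by
    rw [h]; exact (mem_support_expVec α j _).2 ⟨x, rfl⟩).symm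

lemma exists_expVec (m : ℕ+ →₀ ℕ) : ∃ (α : List ℕ+) (i : Fin α.length ↪o ℕ+), m = expVec α i := by
  classical
  let s := m.support.orderEmbOfFin rfl
  let α : List ℕ+ := List.ofFn fun j => Nat.toPNat' (m (s j))
  have hl : α.length = m.support.card := by simp [α]
  let i : Fin α.length ↪o ℕ+ := (Fin.castOrderIso hl).toOrderEmbedding.trans s
  refine ⟨α, i, ?_⟩
  ext x
  by_cases hx : x ∈ m.support
  · have : x ∈ Set.range s := by simpa [s] using hx
    obtain ⟨j, rfl⟩ := this
    have := expVec_apply α i ((Fin.castOrderIso hl).symm j)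
    have hij : i ((Fin.castOrderIso hl).symm j) = s j := by simp [i]
    rw [hij] at this
    rw [this]
    have hpos : 0 < m (s j) := Nat.pos_of_ne_zero (Finsupp.mem_support_iff.1 hx)
    simp [α, Nat.toPNat'_coe, hpos]
  · rw [Finsupp.notMem_support_iff.1 hx]
    symm
    rw [← Finsupp.notMem_support_iff, mem_support_expVec]
    rintro ⟨j, rfl⟩
    exact hx (Finset.orderEmbOfFin_mem m.support rfl _)

variable (K : Type v) [Field K]

lemma coeff_monomialQSym (α β : List ℕ+) (i : Fin β.length ↪o ℕ+) :
    MvPowerSeries.coeff (expVec β i) (monomialQSym K α) = if α = β then 1 else 0 := by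
  change ((Nat.card {a : Fin α.length ↪o ℕ+ // expVec α a = expVec β i} : ℕ) : K) = _
  split_ifs with h
  · subst h
    have : Nat.card {a : Fin α.length ↪o ℕ+ // expVec α a = expVec α i} = 1 := by
      rw [Nat.card_eq_one_iff_unique]
      exact ⟨⟨fun a b => Subtype.ext (expVec_right_inj (a.2.trans b.2.symm))⟩, ⟨⟨i, rfl⟩⟩⟩
    simp [this]
  · have : IsEmpty {a : Fin α.length ↪o ℕ+ // expVec α a = expVec β i} :=
      ⟨fun a => h (expVec_left_inj a.2)⟩
    simp

/-- Some increasing sequence of `k` positive integers. -/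
def initEmb (k : ℕ) : Fin k ↪o ℕ+ :=
  OrderEmbedding.ofStrictMono (fun j => ⟨j + 1, Nat.succ_pos _⟩) fun a b h => by
    change (a : ℕ) + 1 < b + 1
    simpa using h

lemma linearIndependent_monomialQSym : LinearIndependent K (monomialQSym K) := by
  rw [linearIndependent_iff]
  intro l hl
  ext β
  have := congrArg (MvPowerSeries.coeff (expVec β (initEmb _))) hl
  rw [Finsupp.linearCombination_apply, Finsupp.sum, map_sum] at this
  simpa [coeff_monomialQSym] using this

/-- The coefficients of `x_{i_1}^{a_1} ⋯ x_{i_k}^{a_k}` and `x_{j_1}^{a_1} ⋯ x_{j_k}^{a_k}` in `f`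
agree whenever `i_1 < ⋯ < i_k` and `j_1 < ⋯ < j_k`, and `f` has bounded degree. -/
def IsQuasisymmetric {K : Type v} [Field K] (f : MvPowerSeries ℕ+ K) : Prop :=
  (∀ (k : ℕ) (a : Fin k →₀ ℕ) (i j : Fin k ↪o ℕ+),
    MvPowerSeries.coeff (a.embDomain i.toEmbedding) f =
      MvPowerSeries.coeff (a.embDomain j.toEmbedding) f) ∧
  ∃ N, ∀ m, MvPowerSeries.coeff m f ≠ 0 → m.degree ≤ N

variable {K}

/-- The parts of a composition as a finitely supported function. -/
noncomputable def expo (α : List ℕ+) : Fin α.length →₀ ℕ :=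
  Finsupp.equivFunOnFinite.symm fun j => (α.get j : ℕ)

lemma IsQuasisymmetric.mul {f g : MvPowerSeries ℕ+ K} (hf : IsQuasisymmetric f)
    (hg : IsQuasisymmetric g) : IsQuasisymmetric (f * g) := by
  classical
  obtain ⟨N, hN⟩ := hf.2
  obtain ⟨N', hN'⟩ := hg.2
  refine ⟨fun k a i j => ?_, N + N', fun m hm => ?_⟩
  · have key : ∀ i : Fin k ↪o ℕ+, MvPowerSeries.coeff (a.embDomain i.toEmbedding) (f * g) =
        ∑ p ∈ Finset.HasAntidiagonal.antidiagonal a, MvPowerSeries.coeff (p.1.embDomain i.toEmbedding) f *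
          MvPowerSeries.coeff (p.2.embDomain i.toEmbedding) g := by
      intro i
      rw [MvPowerSeries.coeff_mul, ← Finsupp.image_prodMap_embDomain_antidiagonal,
        Finset.sum_image]
      · rfl
      · rintro ⟨a, b⟩ _ ⟨c, d⟩ _ h
        simpa [Prod.ext_iff, (Finsupp.embDomain_injective _).eq_iff] using h
    rw [key i, key j]
    exact Finset.sum_congr rfl fun p _ => by rw [hf.1 k p.1 i j, hg.1 k p.2 i j]
  · rw [MvPowerSeries.coeff_mul] at hm
    obtain ⟨p, hp, hne⟩ := Finset.exists_ne_zero_of_sum_ne_zero hm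
    rw [← Finset.HasAntidiagonal.mem_antidiagonal.1 hp, map_add]
    exact add_le_add (hN _ (left_ne_zero_of_mul hne)) (hN' _ (right_ne_zero_of_mul hne))

lemma expVec_eq_embDomain (α : List ℕ+) (i : Fin α.length ↪o ℕ+) :
    expVec α i =
      (expo α).embDomain i.toEmbedding := by
  classical
  ext x
  by_cases hx : ∃ j, i j = x
  · obtain ⟨j, rfl⟩ := hx
    rw [expVec_apply]
    exact (Finsupp.embDomain_apply_self i.toEmbedding (expo α) j).symm
  · rw [Finsupp.embDomain_of_notMem_range _ _ _ (by simpa using hx), ← Finsupp.notMem_support_iff,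
      mem_support_expVec]
    exact hx

lemma degree_expVec (α : List ℕ+) (i : Fin α.length ↪o ℕ+) :
    (expVec α i).degree = (α.map (fun a : ℕ+ => (a : ℕ))).sum := by
  rw [expVec, map_sum]
  simp only [Finsupp.degree_single]
  rw [← List.sum_ofFn]
  congr 1
  conv_rhs => rw [← List.ofFn_get α, List.map_ofFn]
  rfl

lemma isQuasisymmetric_monomialQSym (α : List ℕ+) : IsQuasisymmetric (monomialQSym K α) := by
  classical
  refine ⟨fun k a i j => ?_, (α.map (fun a : ℕ+ => (a : ℕ))).sum, fun m hm => ?_⟩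
  · obtain ⟨β, s, hs⟩ := exists_expVec (a.embDomain i.toEmbedding)
    have hr : ∀ x, ∃ y, i y = s x := by
      intro x
      by_contra! h
      have h1 := (mem_support_expVec β s (s x)).2 ⟨x, rfl⟩
      rw [← hs, Finsupp.mem_support_iff] at h1
      exact h1 (Finsupp.embDomain_of_notMem_range _ _ _ (by simpa using h))
    choose t ht using hr
    let t' : Fin β.length ↪o Fin k := OrderEmbedding.ofStrictMono t fun x y hxy => by
      rw [← i.lt_iff_lt, ht, ht]; exact s.strictMono hxy
    have e1 : s.toEmbedding = t'.toEmbedding.trans i.toEmbedding := by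
      refine DFunLike.ext _ _ fun x => ?_
      exact (ht x).symm
    have e2 : a = (expo β).embDomain t'.toEmbedding := by
      apply Finsupp.embDomain_injective i.toEmbedding
      rw [hs, expVec_eq_embDomain, e1, Finsupp.embDomain_trans_apply]
    have e3 : ∀ i : Fin k ↪o ℕ+, a.embDomain i.toEmbedding = expVec β (t'.trans i) := fun i => by
      rw [expVec_eq_embDomain, e2, ← Finsupp.embDomain_trans_apply]
      rfl
    rw [e3 i, e3 j, coeff_monomialQSym, coeff_monomialQSym]
  · obtain ⟨β, s, rfl⟩ := exists_expVec m
    rw [coeff_monomialQSym] at hm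
    obtain rfl : α = β := by
      by_contra h
      simp [h] at hm
    exact (degree_expVec α s).le

lemma finite_compositions (N : ℕ) :
    {α : List ℕ+ | (α.map (fun a : ℕ+ => (a : ℕ))).sum ≤ N}.Finite := by
  refine ((List.finite_length_le (Fin (N + 1)) N).image
    (List.map fun j : Fin (N + 1) => Nat.toPNat' j)).subset fun α hα => ?_
  have hle : ∀ a ∈ α, (a : ℕ) ≤ N := fun a ha =>
    (List.single_le_sum (by simp) _ (List.mem_map_of_mem ha)).trans hα
  refine ⟨α.map fun a : ℕ+ => Fin.ofNat (N + 1) (a : ℕ), ?_, ?_⟩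
  · have : α.length ≤ (α.map (fun a : ℕ+ => (a : ℕ))).sum := by
      have := List.length_le_sum_of_one_le (α.map (fun a : ℕ+ => (a : ℕ))) (by
        intro i hi
        obtain ⟨a, _, rfl⟩ := List.mem_map.1 hi
        exact a.pos)
      simpa using this
    simpa using this.trans hα
  · rw [List.map_map]
    conv_rhs => rw [← List.map_id α]
    refine List.map_congr_left fun a ha => ?_
    have : (a : ℕ) % (N + 1) = a := Nat.mod_eq_of_lt (Nat.lt_succ_of_le (hle a ha))
    simp [Fin.ofNat, this]

lemma mem_span_monomialQSym_iff {f : MvPowerSeries ℕ+ K} :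
    f ∈ Submodule.span K (Set.range (monomialQSym K)) ↔ IsQuasisymmetric f := by
  classical
  constructor
  · intro hf
    induction hf using Submodule.span_induction with
    | mem x hx => obtain ⟨α, rfl⟩ := hx; exact isQuasisymmetric_monomialQSym α
    | zero => exact ⟨fun _ _ _ _ => by simp, 0, fun m hm => by simp at hm⟩
    | add x y _ _ hx hy =>
      obtain ⟨N, hN⟩ := hx.2
      obtain ⟨N', hN'⟩ := hy.2
      refine ⟨fun k a i j => ?_, max N N', fun m hm => ?_⟩
      · rw [map_add, map_add, hx.1 k a i j, hy.1 k a i j]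
      · by_cases h : MvPowerSeries.coeff m x = 0
        · refine (hN' m fun h' => hm ?_).trans (le_max_right _ _)
          rw [map_add, h, h', add_zero]
        · exact (hN m h).trans (le_max_left _ _)
    | smul c x _ hx =>
      obtain ⟨N, hN⟩ := hx.2
      refine ⟨fun k a i j => ?_, N, fun m hm => hN m fun h => hm ?_⟩
      · rw [map_smul, map_smul, hx.1 k a i j]
      · rw [map_smul, h, smul_zero]
  · rintro ⟨hq, N, hN⟩
    have : f = ∑ α ∈ (finite_compositions N).toFinset,
        MvPowerSeries.coeff (expVec α (initEmb _)) f • monomialQSym K α := by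
      ext m
      obtain ⟨β, s, rfl⟩ := exists_expVec m
      have h1 : MvPowerSeries.coeff (expVec β s) f =
          MvPowerSeries.coeff (expVec β (initEmb _)) f := by
        rw [expVec_eq_embDomain, expVec_eq_embDomain]
        exact hq _ _ _ _
      rw [map_sum, h1]
      simp only [map_smul, coeff_monomialQSym, smul_eq_mul, mul_ite, mul_one, mul_zero,
        Finset.sum_ite_eq', Set.Finite.mem_toFinset, Set.mem_ofPred_eq]
      split_ifs with h
      · rfl
      · by_contra hne
        exact h (degree_expVec β (initEmb _) ▸ hN _ hne)
    rw [this]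
    exact Submodule.sum_mem _ fun α _ => Submodule.smul_mem _ _ (Submodule.subset_span ⟨α, rfl⟩)

lemma isQuasisymmetric_one : IsQuasisymmetric (1 : MvPowerSeries ℕ+ K) := by
  classical
  refine ⟨fun k a i j => ?_, 0, fun m hm => ?_⟩
  · simp [MvPowerSeries.coeff_one]
  · rw [MvPowerSeries.coeff_one] at hm
    obtain rfl : m = 0 := by
      by_contra h
      simp [h] at hm
    simp

variable (K)

/-- The algebra of quasisymmetric functions: the subalgebra of the algebra of formal power series
in `x₁, x₂, …` spanned by the monomial quasisymmetric functions. -/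
noncomputable def QSym : Subalgebra K (MvPowerSeries ℕ+ K) :=
  (Submodule.span K (Set.range (monomialQSym K))).toSubalgebra
    (mem_span_monomialQSym_iff.2 isQuasisymmetric_one)
    (fun _ _ hf hg => mem_span_monomialQSym_iff.2
      ((mem_span_monomialQSym_iff.1 hf).mul (mem_span_monomialQSym_iff.1 hg)))

/-- The basis `(M_α)` of the space of quasisymmetric functions. -/
noncomputable def qsymBasis : Module.Basis (List ℕ+) K (QSym K) :=
  Module.Basis.span (linearIndependent_monomialQSym K)

lemma coe_qsymBasis (α : List ℕ+) :
    ((qsymBasis K α : QSym K) : MvPowerSeries ℕ+ K) = monomialQSym K α :=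
  congrArg Subtype.val (Module.Basis.span_apply (linearIndependent_monomialQSym K) α)

/-- The coproduct of quasisymmetric functions is deconcatenation,
`Δ(M_α) = ∑_{α = β γ} M_β ⊗ M_γ`; the counit sends `M_()` to `1` and the other `M_α` to `0`. -/
noncomputable instance : CoalgebraStruct K (QSym K) where
  comul := (qsymBasis K).constr K fun α => ∑ i ∈ Finset.range (α.length + 1),
    qsymBasis K (α.take i) ⊗ₜ[K] qsymBasis K (α.drop i)
  counit := (qsymBasis K).constr K fun α => if α = [] then 1 else 0

/-- The homogeneous component spanned by the `M_α` with `α` a composition of `n`. -/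
noncomputable def qsymDegree (n : ℕ) : Submodule K (QSym K) :=
  Submodule.span K {x | ∃ α : List ℕ+, (α.map (fun a : ℕ+ => (a : ℕ))).sum = n ∧ x = qsymBasis K α}

/-- The character `ζ_Q`, equal to `1` on `M_α` if `α = (n)` for some `n ≥ 0` (for `n = 0` this is
the empty composition) and to `0` on the other `M_α`. -/
noncomputable def zetaQSym : QSym K →ₗ[K] K :=
  (qsymBasis K).constr K fun α => if α.length ≤ 1 then 1 else 0

end QSym

/-! ## The universal morphism -/

/-- `Ψ` is a morphism of combinatorial Hopf algebras from the Hopf algebra of posets with the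
character `ζ_q` to quasisymmetric functions with the character `ζ_Q`: a morphism of bialgebras
(hence of Hopf algebras) which is homogeneous of degree `0` and satisfies `ζ_Q ∘ Ψ = ζ_q`. -/
def IsCombinatorialHopfMorphism {K : Type v} [Field K] (q : K)
    (Ψ : PosetAlg.{u} K →ₐc[K] QSym K) : Prop :=
  (∀ n, ∀ x ∈ posetDegree K n, Ψ x ∈ qsymDegree K n) ∧
  ∀ x, zetaQSym K (Ψ x) = zetaPoset K q x

/-! ## The poset cone and its weighted enumerator -/

section Geometry

variable {ι : Type u} [Fintype ι]

/-- The nonempty faces of a polyhedron `C` in `ℝ^ι`: the nonempty sets of all maximizers on `C` of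
a linear functional. The polyhedron itself is a face. -/
def faces (C : Set (ι → ℝ)) : Set (Set (ι → ℝ)) := {G | G.Nonempty ∧ IsExposed ℝ C G}

/-- The normal cone of `C` at `G`: the vectors `w` such that `⟨w, ·⟩` is maximized over `C` at
every point of `G`. -/
def normalCone (C G : Set (ι → ℝ)) : Set (ι → ℝ) :=
  {w | ∀ x ∈ G, ∀ y ∈ C, w ⬝ᵥ y ≤ w ⬝ᵥ x}

/-- `F_q(G) = q^{dim G} ∑_ω x_{ω_1} ⋯ x_{ω_n}` over the positive integer vectors `ω` in the
relative interior of the normal cone at the face `G`. -/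
noncomputable def faceEnumerator {K : Type v} [Field K] (q : K) (C G : Set (ι → ℝ)) :
    MvPowerSeries ℕ+ K :=
  q ^ Module.finrank ℝ (vectorSpan ℝ G) •
    formalSum K (fun ω : {ω : ι → ℕ+ //
        (fun i => ((ω i : ℕ) : ℝ)) ∈ intrinsicInterior ℝ (normalCone C G)} =>
      ∑ i, Finsupp.single (ω.1 i) 1)

/-- The weighted enumerator `F_q(C) = ∑_G F_q(G)` over the faces `G` of a polyhedron `C`. -/
noncomputable def weightedEnumerator {K : Type v} [Field K] (q : K) (C : Set (ι → ℝ)) :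
    MvPowerSeries ℕ+ K :=
  ∑ᶠ G ∈ faces C, faceEnumerator q C G

end Geometry

open Classical in
/-- The poset cone `C(P) = cone {e_i - e_j : i <_P j}`. -/
noncomputable def posetCone (P : Type u) [PartialOrder P] : Set (P → ℝ) :=
  (PointedCone.hull ℝ
    {x | ∃ i j : P, i < j ∧ x = Pi.single i 1 - Pi.single j 1} : PointedCone ℝ (P → ℝ))

/-! ## Flags of ideals -/

/-- Flags of ideals `∅ = F_0 ⊂ F_1 ⊂ ⋯ ⊂ F_k = P` (strict inclusions) of a poset `P`. -/
def IdealFlag (P : Type u) [PartialOrder P] : Type u :=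
  {F : LTSeries (LowerSet P) // F.head = ⊥ ∧ F.last = ⊤}

open Classical in
noncomputable instance (P : Type u) [PartialOrder P] [Fintype P] : Fintype (IdealFlag P) :=
  inferInstanceAs (Fintype {F : LTSeries (LowerSet P) // F.head = ⊥ ∧ F.last = ⊤})

namespace IdealFlag

variable {P : Type u} [PartialOrder P]

/-- The block `F_{i+1} ∖ F_i` of a flag. -/
def block (F : IdealFlag P) (i : Fin F.1.length) : Set P :=
  (F.1 i.succ : Set P) \ (F.1 i.castSucc : Set P)

lemma block_nonempty (F : IdealFlag P) (i : Fin F.1.length) : (F.block i).Nonempty :=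
  Set.sdiff_nonempty.2 (not_le_of_gt (F.1.step i))

/-- The type `(|F_1 ∖ F_0|, …, |F_k ∖ F_{k-1}|)` of a flag. -/
noncomputable def type [Fintype P] (F : IdealFlag P) : List ℕ+ :=
  List.ofFn fun i => ⟨(F.block i).ncard, (Set.ncard_pos).2 (F.block_nonempty i)⟩

/-- `rk_P(F)`, the sum of the ranks of the restrictions of `P` to the blocks of the flag. -/
noncomputable def rank (F : IdealFlag P) : ℕ := ∑ i, posetRank (F.block i)

end IdealFlag

end PosetQSym

open PosetQSym

/-! All sides of the theorem equal one power series, `enumerator q P`: the sum of q^(`levelRank f`)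
∏ x_{f p} over the monotone maps f from P to the positive integers, where `levelRank f` is the
dimension of the span of the e_i - e_j with i < j and f i = f j.

Geometry. The pairing of w with e_i - e_j is w_i - w_j, so w is bounded above on C(P) exactly when
it is monotone. It is then maximal on the face generated by the e_i - e_j with i < j and w_i = w_j
(`maximizers_genCone`), whose dimension is the level rank (`finrank_maximizers`). The relative
interior of a normal cone consists of the vectors maximal exactly on the given face
(`mem_intrinsicInterior_normalCone_iff`), so summing over faces amounts to summing over monotone
maps.

Algebra. Restriction to the summands of a disjoint union makes the enumerator multiplicative
(`monotoneSum_sum`). If all variables of m₁ precede those of m₂, a monotone map of content m₁ + m₂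
is an ideal, where its values are small, with monotone maps on the ideal and on its complement
(`monotoneSum_add`); this matches the coproduct with deconcatenation. The coefficient of x_1^n with
n = |P| sees only a constant map, of weight q^rk(P), which gives the character. For uniqueness, the
coefficient of M_α is given by the counit if α is empty, by degree and character if α has one part,
and by splitting off the first part with the coproduct otherwise.

Flags. A monotone map with k values becomes, after relabelling, a monotone surjection onto Fin k,
that is, a flag of ideals whose blocks are the fibres. The weights agree because ranks add over
fibres (`relRank_fiber`). -/

namespace PosetQSym

set_option linter.unusedSectionVars false

/-! ## Ranks of relations -/

section RelRank

variable {V A B : Type*}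

open Classical in
/-- The span of the vectors `e_i - e_j` with `r i j`. -/
noncomputable def relSpan (r : V → V → Prop) : Submodule ℝ (V → ℝ) :=
  Submodule.span ℝ {x | ∃ i j, r i j ∧ x = Pi.single i 1 - Pi.single j 1}

/-- The dimension of the span of the vectors `e_i - e_j` with `r i j`. -/
noncomputable def relRank (r : V → V → Prop) : ℕ := Module.finrank ℝ (relSpan r)

/-- The functions which agree at related elements. -/
def relConst (r : V → V → Prop) : Submodule ℝ (V → ℝ) where
  carrier := {x | ∀ i j, r i j → x i = x j}
  add_mem' hx hy i j h := by simp [hx i j h, hy i j h]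
  zero_mem' _ _ _ := rfl
  smul_mem' c x hx i j h := by simp [hx i j h]

lemma mem_relConst {r : V → V → Prop} {x : V → ℝ} :
    x ∈ relConst r ↔ ∀ i j, r i j → x i = x j := Iff.rfl

/-- Under the dot product, `relConst r` is the annihilator of `relSpan r`. Ranks can therefore be
compared through spaces of functions, which are easy to transport along bijections and to decompose
as products. -/
lemma relRank_add_finrank_relConst [Finite V] (r : V → V → Prop) :
    relRank r + Module.finrank ℝ (relConst r) = Nat.card V := by
  classical
  have := Fintype.ofFinite V
  have h : (relSpan r).dualAnnihilator.comap (dotProductEquiv ℝ V).toLinearMap = relConst r := by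
    ext x
    rw [Submodule.mem_comap, Submodule.mem_dualAnnihilator, mem_relConst]
    constructor
    · intro hx i j hij
      have := hx (Pi.single i 1 - Pi.single j 1)
        (Submodule.subset_span ⟨i, j, hij, by congr!⟩)
      simpa [dotProduct_sub, sub_eq_zero] using this
    · intro hx w hw
      induction hw using Submodule.span_induction with
      | mem w hw =>
        obtain ⟨i, j, hij, rfl⟩ := hw
        have := hx i j hij
        have e : (@Pi.single V (fun _ => ℝ) _ (fun a b => Classical.propDecidable (a = b)) i 1
            - @Pi.single V (fun _ => ℝ) _ (fun a b => Classical.propDecidable (a = b)) j 1) =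
            (Pi.single i 1 - Pi.single j 1 : V → ℝ) := by congr!
        rw [e]
        simp [dotProduct_sub, this]
      | zero => simp
      | add a b _ _ ha hb => rw [map_add, ha, hb, add_zero]
      | smul c a _ ha => rw [map_smul, ha, smul_zero]
  have h2 : Module.finrank ℝ (relConst r) = Module.finrank ℝ (relSpan r).dualAnnihilator := by
    rw [← h]
    exact ((dotProductEquiv ℝ V).ofSubmodule' _).finrank_eq
  rw [relRank, h2, Subspace.finrank_add_finrank_dualAnnihilator_eq, Module.finrank_fintype_fun_eq_card,
    Nat.card_eq_fintype_card]

/-- The kernel of the graph Laplacian consists of the functions constant along edges, and its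
dimension is the number of connected components. -/
lemma posetRank_eq_relRank (P : Type u) [PartialOrder P] [Finite P] :
    posetRank P = relRank (fun i j : P => i < j) := by
  classical
  have := Fintype.ofFinite P
  have h : numComponents P = Module.finrank ℝ (relConst (fun i j : P => i < j)) := by
    rw [numComponents, Nat.card_eq_fintype_card,
      (comparabilityGraph P).card_connectedComponent_eq_finrank_ker_toLin'_lapMatrix]
    suffices e : (Matrix.toLin' (SimpleGraph.lapMatrix ℝ (comparabilityGraph P))).ker =
        relConst fun i j => i < j by rw [← e]
    ext x
    rw [LinearMap.mem_ker, Matrix.toLin'_apply,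
      SimpleGraph.lapMatrix_mulVec_eq_zero_iff_forall_adj, mem_relConst]
    simp only [comparabilityGraph, SimpleGraph.fromRel_adj]
    constructor
    · exact fun H i j hij => H i j ⟨hij.ne, Or.inl hij⟩
    · rintro H i j ⟨-, hij | hij⟩
      · exact H i j hij
      · exact (H j i hij).symm
  rw [posetRank, h, ← relRank_add_finrank_relConst (fun i j : P => i < j), Nat.add_sub_cancel]

lemma relRank_equiv [Finite V] (e : A ≃ V) (r : V → V → Prop) :
    relRank (fun a b => r (e a) (e b)) = relRank r := by
  have := Finite.of_equiv V e.symm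
  have h1 := relRank_add_finrank_relConst r
  have h2 := relRank_add_finrank_relConst (fun a b => r (e a) (e b))
  have h3 : relConst (fun a b => r (e a) (e b)) ≃ₗ[ℝ] relConst r :=
    { toFun := fun x => ⟨fun v => x.1 (e.symm v), fun i j h => x.2 _ _ (by simpa using h)⟩
      invFun := fun y => ⟨fun a => y.1 (e a), fun i j h => y.2 _ _ h⟩
      map_add' := fun _ _ => rfl
      map_smul' := fun _ _ => rfl
      left_inv := fun x => by ext; simp
      right_inv := fun y => by ext; simp }
  rw [h3.finrank_eq, Nat.card_congr e] at h2
  omega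

/-- Ranks add up over the pieces of a partition into unrelated pieces. -/
lemma relRank_sigma {ι : Type*} [Finite ι] {A : ι → Type*} [∀ i, Finite (A i)]
    (r : (Σ i, A i) → (Σ i, A i) → Prop)
    (hr : ∀ i j a b, r ⟨i, a⟩ ⟨j, b⟩ → i = j) :
    relRank r = ∑ᶠ i, relRank (fun a b : A i => r ⟨i, a⟩ ⟨i, b⟩) := by
  have := Fintype.ofFinite ι
  rw [finsum_eq_sum_of_fintype]
  have h1 := relRank_add_finrank_relConst r
  have h2 := fun i => relRank_add_finrank_relConst (fun a b : A i => r ⟨i, a⟩ ⟨i, b⟩)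
  -- With no relations between pieces, a function agreeing at related elements is an independent
  -- choice on each piece, so codimensions add.
  let e : relConst r ≃ₗ[ℝ] (∀ i, relConst (fun a b : A i => r ⟨i, a⟩ ⟨i, b⟩)) :=
    { toFun := fun x i => ⟨fun a => x.1 ⟨i, a⟩, fun a b h => x.2 _ _ h⟩
      invFun := fun y => ⟨fun p => (y p.1).1 p.2, by
        rintro ⟨i, a⟩ ⟨j, b⟩ h
        obtain rfl := hr _ _ _ _ h
        exact (y i).2 a b h⟩
      map_add' := fun _ _ => rfl
      map_smul' := fun _ _ => rfl
      left_inv := fun _ => rfl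
      right_inv := fun _ => rfl }
  rw [e.finrank_eq, Module.finrank_pi_fintype, Nat.card_sigma, ← Finset.sum_congr rfl fun i _ => h2 i,
    Finset.sum_add_distrib] at h1
  omega

lemma relRank_fiber {ι : Type*} [Finite ι] [Finite V] (f : V → ι) (r : V → V → Prop)
    (hr : ∀ a b, r a b → f a = f b) :
    relRank r = ∑ᶠ i, relRank (fun a b : {v // f v = i} => r a b) := by
  rw [← relRank_equiv (Equiv.sigmaFiberEquiv f) r, relRank_sigma]
  · rfl
  · rintro i j ⟨a, rfl⟩ ⟨b, rfl⟩ h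
    exact hr _ _ h

/-- Ranks add up over a partition into two unrelated pieces. -/
lemma relRank_sum [Finite A] [Finite B] (e : A ⊕ B ≃ V) (r : V → V → Prop)
    (h₁ : ∀ a b, ¬ r (e (.inl a)) (e (.inr b))) (h₂ : ∀ a b, ¬ r (e (.inr b)) (e (.inl a))) :
    relRank r = relRank (fun a b => r (e (.inl a)) (e (.inl b))) +
      relRank (fun a b => r (e (.inr a)) (e (.inr b))) := by
  have := Finite.of_equiv _ e
  rw [← relRank_equiv e r]
  have k := relRank_add_finrank_relConst (fun a b => r (e a) (e b))
  have k₁ := relRank_add_finrank_relConst (fun a b => r (e (.inl a)) (e (.inl b)))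
  have k₂ := relRank_add_finrank_relConst (fun a b => r (e (.inr a)) (e (.inr b)))
  let E : relConst (fun a b => r (e a) (e b)) ≃ₗ[ℝ]
      relConst (fun a b => r (e (.inl a)) (e (.inl b))) ×
      relConst (fun a b => r (e (.inr a)) (e (.inr b))) :=
    { toFun := fun x => (⟨fun a => x.1 (.inl a), fun a b h => x.2 _ _ h⟩,
        ⟨fun a => x.1 (.inr a), fun a b h => x.2 _ _ h⟩)
      invFun := fun y => ⟨Sum.elim y.1.1 y.2.1, by
        rintro (a | a) (b | b) h
        · exact y.1.2 _ _ h
        · exact (h₁ _ _ h).elim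
        · exact (h₂ _ _ h).elim
        · exact y.2.2 _ _ h⟩
      map_add' := fun x y => rfl
      map_smul' := fun c x => rfl
      left_inv := fun x => by ext (a | a) <;> rfl
      right_inv := fun y => rfl }
  rw [E.finrank_eq, Module.finrank_prod, Nat.card_sum] at k
  omega

end RelRank

/-! ## Monotone maps of given content -/

section MonotoneSum

variable {P : Type u} {Q : Type u} {L : Type*} {L' : Type*}

/-- The exponent of the monomial `∏ x_{f p}`. -/
noncomputable def content [Fintype P] (f : P → L) : L →₀ ℕ := ∑ p, Finsupp.single (f p) 1

lemma mem_support_content [Fintype P] {f : P → L} {x : L} :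
    x ∈ (content f).support ↔ ∃ p, f p = x := by
  classical
  rw [Finsupp.mem_support_iff, content, Finsupp.finsetSum_apply, Ne, Finset.sum_eq_zero_iff]
  simp [Finsupp.single_apply]

lemma content_mem_support [Fintype P] (f : P → L) (p : P) : f p ∈ (content f).support :=
  mem_support_content.2 ⟨p, rfl⟩

lemma degree_content [Fintype P] (f : P → L) : (content f).degree = Fintype.card P := by
  simp [content, map_sum]

lemma content_comp_equiv [Fintype P] [Fintype Q] (f : Q → L) (e : P ≃ Q) :
    content (f ∘ e) = content f :=
  Fintype.sum_equiv e _ _ fun _ => rfl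

lemma content_sum {A B : Type u} [Fintype A] [Fintype B] (f : A ⊕ B → L) :
    content f = content (f ∘ Sum.inl) + content (f ∘ Sum.inr) := by
  rw [content, Fintype.sum_sum_type]
  rfl

lemma content_embDomain [Fintype P] (f : P → L) (φ : L ↪ L') :
    (content f).embDomain φ = content (φ ∘ f) := by
  rw [content, Finsupp.embDomain_eq_mapDomain, Finsupp.mapDomain_finsetSum]
  simp [content]

/-- The rank of the relation `i < j, f i = f j`. -/
noncomputable def levelRank [Preorder P] (f : P → L) : ℕ :=
  relRank (fun i j => i < j ∧ f i = f j)

/-- The monotone maps from `P` of content `m`. -/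
abbrev MonotoneMap (P : Type u) [PartialOrder P] [Fintype P] [Preorder L] (m : L →₀ ℕ) :=
  {f : P → L // Monotone f ∧ content f = m}

variable [PartialOrder P] [Fintype P] [PartialOrder Q] [Fintype Q] [LinearOrder L] [LinearOrder L']

lemma MonotoneMap.mem_support {m : L →₀ ℕ} (f : MonotoneMap P m) (p : P) :
    f.1 p ∈ m.support := by
  obtain ⟨f, -, rfl⟩ := f
  exact content_mem_support f p

instance (m : L →₀ ℕ) : Finite (MonotoneMap P m) := by
  refine Finite.of_injective
    (fun f : MonotoneMap P m => fun p => (⟨f.1 p, f.mem_support p⟩ : m.support))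
    fun f g h => Subtype.ext <| funext fun p => ?_
  exact congrArg Subtype.val (congrFun h p)

noncomputable instance (m : L →₀ ℕ) : Fintype (MonotoneMap P m) := Fintype.ofFinite _

variable {K : Type v} [Field K] (q : K)

/-- The sum of `q ^ levelRank f` over the monotone maps `f` from `P` of content `m`. -/
noncomputable def monotoneSum (P : Type u) [PartialOrder P] [Fintype P] (m : L →₀ ℕ) : K :=
  ∑ f : MonotoneMap P m, q ^ levelRank f.1

lemma monotoneSum_congr (e : P ≃o Q) (m : L →₀ ℕ) : monotoneSum q P m = monotoneSum q Q m := by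
  refine Fintype.sum_equiv
    { toFun := fun f => ⟨f.1 ∘ e.symm, f.2.1.comp e.symm.monotone,
        (content_comp_equiv f.1 e.symm.toEquiv).trans f.2.2⟩
      invFun := fun f => ⟨f.1 ∘ e, f.2.1.comp e.monotone,
        (content_comp_equiv f.1 e.toEquiv).trans f.2.2⟩
      left_inv := fun f => Subtype.ext <| by ext; simp
      right_inv := fun f => Subtype.ext <| by ext; simp } _ _ fun f => ?_
  congr 1
  change relRank _ = relRank _
  rw [← relRank_equiv e.symm.toEquiv]
  congr! 3
  simp

/-- A map whose content is supported in the range of `φ` factors uniquely through `φ`, with the same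
level sets. This gives quasisymmetry, and it also lets the values be relabelled by `Fin k`. -/
lemma monotoneSum_embDomain (φ : L ↪o L') (m : L →₀ ℕ) :
    monotoneSum q P (m.embDomain φ.toEmbedding) = monotoneSum q P m := by
  symm
  refine Fintype.sum_bijective
    (fun f => ⟨φ ∘ f.1, φ.monotone.comp f.2.1,
      (content_embDomain f.1 φ.toEmbedding).symm.trans (congrArg _ f.2.2)⟩)
    ⟨fun f g h => Subtype.ext (funext fun p => φ.injective ?_), fun g => ?_⟩ _ _ fun f => ?_
  · exact congrFun (congrArg Subtype.val h) p
  · have h : ∀ p, ∃ x, φ x = g.1 p := fun p => by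
      have := g.mem_support p
      rw [Finsupp.support_embDomain, Finset.mem_map] at this
      obtain ⟨x, -, hx⟩ := this
      exact ⟨x, hx⟩
    choose f hf using h
    have hf' : φ ∘ f = g.1 := funext hf
    refine ⟨⟨f, fun a b hab => ?_, Finsupp.embDomain_injective φ.toEmbedding ?_⟩, Subtype.ext hf'⟩
    · rw [← φ.le_iff_le, hf, hf]
      exact g.2.1 hab
    · rw [content_embDomain]
      exact (congrArg content hf').trans g.2.2
  · simp [levelRank]

/-- The hypothesis `h` excludes comparable pairs on a common level lying in different pieces, so no
generator of the level span joins the two pieces. -/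
lemma levelRank_sum {A B : Type u} [PartialOrder A] [PartialOrder B] [Finite A] [Finite B]
    (e : A ⊕ B ≃ P) (f : P → L)
    (hl : ∀ a b, e (.inl a) < e (.inl b) ↔ a < b) (hr : ∀ a b, e (.inr a) < e (.inr b) ↔ a < b)
    (h : ∀ a b, f (e (.inl a)) = f (e (.inr b)) →
      ¬ e (.inl a) < e (.inr b) ∧ ¬ e (.inr b) < e (.inl a)) :
    levelRank f = levelRank (fun a => f (e (.inl a))) + levelRank (fun b => f (e (.inr b))) := by
  rw [levelRank, relRank_sum e]
  · simp [levelRank, hl, hr]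
  · rintro a b ⟨h1, h2⟩
    exact (h a b h2).1 h1
  · rintro a b ⟨h1, h2⟩
    exact (h a b h2.symm).2 h1

open Classical in
/-- Monotone maps on a disjoint union are pairs of monotone maps. -/
noncomputable def monotoneMapSumEquiv (m : L →₀ ℕ) : MonotoneMap (P ⊕ Q) m ≃
    Σ ab : {ab : (L →₀ ℕ) × (L →₀ ℕ) // ab ∈ Finset.HasAntidiagonal.antidiagonal m},
      MonotoneMap P ab.1.1 × MonotoneMap Q ab.1.2 where
  toFun f := ⟨⟨(content (f.1 ∘ Sum.inl), content (f.1 ∘ Sum.inr)), by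
      rw [Finset.HasAntidiagonal.mem_antidiagonal, ← content_sum, f.2.2]⟩,
    ⟨f.1 ∘ Sum.inl, f.2.1.comp Sum.inl_mono, rfl⟩, ⟨f.1 ∘ Sum.inr, f.2.1.comp Sum.inr_mono, rfl⟩⟩
  invFun x := ⟨Sum.elim x.2.1.1 x.2.2.1, by
      rintro (a | a) (b | b) h
      · exact x.2.1.2.1 (Sum.inl_le_inl_iff.1 h)
      · exact (Sum.not_inl_le_inr h).elim
      · exact (Sum.not_inr_le_inl h).elim
      · exact x.2.2.2.1 (Sum.inr_le_inr_iff.1 h), by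
      rw [content_sum, Sum.elim_comp_inl, Sum.elim_comp_inr, x.2.1.2.2, x.2.2.2.2]
      exact Finset.HasAntidiagonal.mem_antidiagonal.1 x.1.2⟩
  left_inv f := Subtype.ext (Sum.elim_comp_inl_inr f.1)
  right_inv := by
    rintro ⟨⟨⟨a, b⟩, h⟩, ⟨f, hf, h1⟩, ⟨g, hg, h2⟩⟩
    dsimp only at h1 h2
    subst h1 h2
    rfl

-- This is multiplicativity of the enumerator, read off coefficient by coefficient.
open Classical in
lemma monotoneSum_sum (m : L →₀ ℕ) :
    monotoneSum q (P ⊕ Q) m =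
      ∑ ab ∈ Finset.HasAntidiagonal.antidiagonal m, monotoneSum q P ab.1 * monotoneSum q Q ab.2 := by
  rw [← Finset.sum_coe_sort, monotoneSum, Fintype.sum_equiv (monotoneMapSumEquiv m) _
    (fun x => q ^ levelRank x.2.1.1 * q ^ levelRank x.2.2.1), Fintype.sum_sigma]
  · refine Finset.sum_congr rfl fun ab _ => ?_
    rw [Fintype.sum_prod_type, monotoneSum, monotoneSum, Finset.sum_mul_sum]
  · intro f
    rw [← pow_add]
    congr 1
    rw [levelRank_sum (Equiv.refl _) f.1]
    · rfl
    · simp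
    · simp
    · simp

end MonotoneSum

/-! ### Splitting monotone maps along an ideal -/

section Split

variable {P : Type u} [PartialOrder P] [Fintype P] {L : Type*} [LinearOrder L]
  {K : Type v} [Field K] (q : K)

open Classical in
/-- The map on `P` with given restrictions to a set and to its complement. -/
noncomputable def glue (S : Set P) (g : S → L) (h : (Sᶜ : Set P) → L) : P → L :=
  Sum.elim g h ∘ (Equiv.Set.sumCompl S).symm

lemma glue_inl (S : Set P) (g : S → L) (h : (Sᶜ : Set P) → L) (a : S) : glue S g h a = g a := by
  simp [glue]

lemma glue_inr (S : Set P) (g : S → L) (h : (Sᶜ : Set P) → L) (a : (Sᶜ : Set P)) :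
    glue S g h a = h a := by
  simp [glue, Equiv.Set.sumCompl_symm_apply_compl]

lemma content_compl (S : Set P) [Fintype S] [Fintype (Sᶜ : Set P)] (f : P → L) :
    content f = content (fun a : S => f a) + content (fun a : (Sᶜ : Set P) => f a) := by
  classical
  rw [← content_comp_equiv f (Equiv.Set.sumCompl S), content_sum]
  rfl

open Classical in
/-- A monotone map of content `m₁ + m₂`, where `m₁` is supported to the left of `m₂`, splits into
monotone maps of content `m₁` and `m₂` on an ideal and on its complement. -/
lemma monotoneSum_add (m₁ m₂ : L →₀ ℕ) (hm : ∀ a ∈ m₁.support, ∀ b ∈ m₂.support, a < b) :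
    monotoneSum q P (m₁ + m₂) = ∑ S : LowerSet P,
      monotoneSum q (S : Set P) m₁ * monotoneSum q ((S : Set P)ᶜ : Set P) m₂ := by
  have hdisj : ∀ a ∈ m₁.support, a ∉ m₂.support := fun a ha hb => lt_irrefl _ (hm a ha a hb)
  -- The ideal is recovered from the glued map as the set of points with value in the support of
  -- `m₁`.
  have key : ∀ (S : LowerSet P) (g : MonotoneMap (S : Set P) m₁)
      (h : MonotoneMap ((S : Set P)ᶜ : Set P) m₂) (p : P),
      p ∈ S ↔ glue (S : Set P) g.1 h.1 p ∈ m₁.support := by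
    intro S g h p
    constructor
    · intro hp
      have := glue_inl (S : Set P) g.1 h.1 ⟨p, hp⟩
      rw [this]
      exact g.mem_support _
    · intro hp
      by_contra hS
      have := glue_inr (S : Set P) g.1 h.1 ⟨p, hS⟩
      rw [this] at hp
      exact hdisj _ hp (h.mem_support _)
  have hrank : ∀ (S : LowerSet P) (f : P → L), (∀ p, p ∈ S ↔ f p ∈ m₁.support) →
      levelRank f = levelRank (fun a : (S : Set P) => f a) +
        levelRank (fun a : ((S : Set P)ᶜ : Set P) => f a) := by
    intro S f hf
    rw [levelRank_sum (Equiv.Set.sumCompl (S : Set P)) f (fun _ _ => Iff.rfl) (fun _ _ => Iff.rfl)]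
    · rfl
    · intro a b hab
      refine absurd ?_ b.2
      change _ ∈ S
      rw [hf]
      have := (hf a).1 a.2
      simp only [Equiv.Set.sumCompl_apply_inl, Equiv.Set.sumCompl_apply_inr] at hab
      rwa [← hab]
  have : ∑ S : LowerSet P,
      monotoneSum q (S : Set P) m₁ * monotoneSum q ((S : Set P)ᶜ : Set P) m₂ =
      ∑ x : (Σ S : LowerSet P, MonotoneMap (S : Set P) m₁ × MonotoneMap ((S : Set P)ᶜ : Set P) m₂),
        q ^ levelRank x.2.1.1 * q ^ levelRank x.2.2.1 := by
    rw [Fintype.sum_sigma]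
    refine Finset.sum_congr rfl fun S _ => ?_
    rw [Fintype.sum_prod_type, monotoneSum, monotoneSum, Finset.sum_mul_sum]
  have hmono : ∀ (S : LowerSet P) (g : MonotoneMap (S : Set P) m₁)
      (h : MonotoneMap ((S : Set P)ᶜ : Set P) m₂), Monotone (glue (S : Set P) g.1 h.1) := by
    intro S g h a b hab
    by_cases ha : a ∈ S <;> by_cases hb : b ∈ S
    · have h1 := glue_inl (S : Set P) g.1 h.1 ⟨a, ha⟩
      have h2 := glue_inl (S : Set P) g.1 h.1 ⟨b, hb⟩
      dsimp only at h1 h2 ⊢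
      rw [h1, h2]
      exact g.2.1 hab
    · refine (hm _ ((key S g h a).1 ha) _ ?_).le
      have h2 := glue_inr (S : Set P) g.1 h.1 ⟨b, hb⟩
      dsimp only at h2 ⊢
      rw [h2]
      exact h.mem_support _
    · exact (ha (S.lower hab hb)).elim
    · have h1 := glue_inr (S : Set P) g.1 h.1 ⟨a, ha⟩
      have h2 := glue_inr (S : Set P) g.1 h.1 ⟨b, hb⟩
      dsimp only at h1 h2 ⊢
      rw [h1, h2]
      exact h.2.1 hab
  have hcont : ∀ (S : LowerSet P) (g : MonotoneMap (S : Set P) m₁)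
      (h : MonotoneMap ((S : Set P)ᶜ : Set P) m₂), content (glue (S : Set P) g.1 h.1) = m₁ + m₂ := by
    intro S g h
    rw [content_compl (S : Set P)]
    simp only [glue_inl, glue_inr]
    exact congrArg₂ (· + ·) g.2.2 h.2.2
  rw [this]
  symm
  refine Fintype.sum_bijective (fun x => ⟨glue (x.1 : Set P) x.2.1.1 x.2.2.1,
    hmono x.1 x.2.1 x.2.2, hcont x.1 x.2.1 x.2.2⟩) ⟨?_, ?_⟩ _ _ ?_
  · rintro ⟨S, g, h⟩ ⟨S', g', h'⟩ e
    have e' : glue (S : Set P) g.1 h.1 = glue (S' : Set P) g'.1 h'.1 := congrArg Subtype.val e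
    obtain rfl : S = S' := by
      ext p
      exact (key S g h p).trans ((iff_of_eq (by rw [e'])).trans (key S' g' h' p).symm)
    obtain rfl : g = g' := Subtype.ext <| funext fun a => by
      rw [← glue_inl (S : Set P) g.1 h.1, e', glue_inl]
    obtain rfl : h = h' := Subtype.ext <| funext fun a => by
      rw [← glue_inr (S : Set P) g.1 h.1, e', glue_inr]
    rfl
  · intro f
    have hf : ∀ p, f.1 p ∈ m₁.support ∨ f.1 p ∈ m₂.support := fun p => by
      have := f.mem_support p
      exact Finset.mem_union.1 (Finsupp.support_add this)
    let S : LowerSet P := ⟨{p | f.1 p ∈ m₁.support}, fun a b hab ha => by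
      rcases hf b with h | h
      · exact h
      · exact ((f.2.1 hab).not_gt (hm _ ha _ h)).elim⟩
    have hc := (content_compl (S : Set P) f.1).symm.trans f.2.2
    -- At a variable of `m₁` both `m₂` and the complement contribute nothing; at any other variable
    -- the restriction to `S` has no value.
    have h1 : content (fun a : (S : Set P) => f.1 a) = m₁ := by
      ext x
      have hx := DFunLike.congr_fun hc x
      rw [Finsupp.add_apply, Finsupp.add_apply] at hx
      by_cases hm1 : x ∈ m₁.support
      · have z1 : m₂ x = 0 := Finsupp.notMem_support_iff.1 (hdisj x hm1)
        have z2 : content (fun a : ((S : Set P)ᶜ : Set P) => f.1 a) x = 0 := by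
          rw [← Finsupp.notMem_support_iff, mem_support_content]
          rintro ⟨p, rfl⟩
          exact p.2 hm1
        omega
      · rw [Finsupp.notMem_support_iff.1 hm1, ← Finsupp.notMem_support_iff, mem_support_content]
        rintro ⟨p, rfl⟩
        exact hm1 p.2
    have h2 : content (fun a : ((S : Set P)ᶜ : Set P) => f.1 a) = m₂ := by
      rw [h1] at hc
      exact add_left_cancel hc
    refine ⟨⟨S, ⟨fun a => f.1 a, fun a b hab => f.2.1 hab, h1⟩,
      ⟨fun a => f.1 a, fun a b hab => f.2.1 hab, h2⟩⟩, Subtype.ext <| funext fun p => ?_⟩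
    by_cases hp : p ∈ (S : Set P)
    · exact glue_inl (S : Set P) _ _ ⟨p, hp⟩
    · exact glue_inr (S : Set P) _ _ ⟨p, hp⟩
  · rintro ⟨S, g, h⟩
    rw [← pow_add]
    congr 1
    symm
    refine (hrank S _ (key S g h)).trans ?_
    simp only [glue_inl, glue_inr]

end Split

open scoped TensorProduct

/-! ## The morphism to quasisymmetric functions -/

section QSymCoord

variable {K : Type v} [Field K]

lemma coeff_expVec (f : QSym K) (α : List ℕ+) (i : Fin α.length ↪o ℕ+) :
    MvPowerSeries.coeff (expVec α i) (f : MvPowerSeries ℕ+ K) = (qsymBasis K).coord α f := by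
  suffices h : (MvPowerSeries.coeff (expVec α i)).comp (QSym K).val.toLinearMap =
      (qsymBasis K).coord α from LinearMap.congr_fun h f
  refine (qsymBasis K).ext fun β => ?_
  rw [Module.Basis.coord_apply, Module.Basis.repr_self, Finsupp.single_apply]
  change MvPowerSeries.coeff (expVec α i) ((qsymBasis K β : QSym K) : MvPowerSeries ℕ+ K) = _
  rw [coe_qsymBasis, coeff_monomialQSym]

/-- The coefficient of `M_α ⊗ M_β`. -/
noncomputable def tensorCoord (α β : List ℕ+) : QSym K ⊗[K] QSym K →ₗ[K] K :=
  (LinearMap.mul' K K).comp (TensorProduct.map ((qsymBasis K).coord α) ((qsymBasis K).coord β))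

lemma tensorCoord_tmul (α β : List ℕ+) (f g : QSym K) :
    tensorCoord α β (f ⊗ₜ[K] g) = (qsymBasis K).coord α f * (qsymBasis K).coord β g := rfl

lemma tensorCoord_ext {x y : QSym K ⊗[K] QSym K}
    (h : ∀ α β, tensorCoord α β x = tensorCoord α β y) : x = y := by
  refine ((qsymBasis K).tensorProduct (qsymBasis K)).ext_elem fun ⟨α, β⟩ => ?_
  have key : ((qsymBasis K).tensorProduct (qsymBasis K)).coord (α, β) = tensorCoord α β := by
    refine TensorProduct.ext' fun f g => ?_
    rw [tensorCoord_tmul, Module.Basis.coord_apply, Module.Basis.tensorProduct_repr_tmul_apply,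
      mul_comm]
    rfl
  have := h α β
  rwa [← key] at this

lemma comul_qsymBasis (α : List ℕ+) : CoalgebraStruct.comul (R := K) (qsymBasis K α) =
    ∑ i ∈ Finset.range (α.length + 1),
      qsymBasis K (α.take i) ⊗ₜ[K] qsymBasis K (α.drop i) :=
  (qsymBasis K).constr_basis K _ α

lemma counit_eq_coord : CoalgebraStruct.counit (R := K) (A := QSym K) = (qsymBasis K).coord [] := by
  refine (qsymBasis K).ext fun α => ?_
  rw [Module.Basis.coord_apply, Module.Basis.repr_self, Finsupp.single_apply]
  exact (qsymBasis K).constr_basis K _ α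

/-- Deconcatenation is dual to concatenation: the only cut of α ++ β that yields the pair (α, β) is
the one after `α.length` parts. -/
lemma tensorCoord_comul (α β : List ℕ+) (f : QSym K) :
    tensorCoord α β (CoalgebraStruct.comul (R := K) f) = (qsymBasis K).coord (α ++ β) f := by
  suffices h : (tensorCoord α β).comp (CoalgebraStruct.comul (R := K) (A := QSym K)) =
      (qsymBasis K).coord (α ++ β) from LinearMap.congr_fun h f
  refine (qsymBasis K).ext fun γ => ?_
  rw [LinearMap.comp_apply, comul_qsymBasis, map_sum]
  simp only [tensorCoord_tmul, Module.Basis.coord_apply, Module.Basis.repr_self,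
    Finsupp.single_apply]
  by_cases h : γ = α ++ β
  · subst h
    rw [Finset.sum_eq_single α.length]
    · simp
    · intro i hi hne
      rw [Finset.mem_range, Nat.lt_succ_iff] at hi
      rw [if_neg, zero_mul]
      intro h'
      have := congrArg List.length h'
      rw [List.length_take, min_eq_left hi] at this
      exact hne this
    · simp
  · rw [if_neg h]
    refine Finset.sum_eq_zero fun i _ => ?_
    split_ifs with h1 h2
    · exact (h (by rw [← h1, ← h2, List.take_append_drop])).elim
    all_goals simp

lemma eq_of_sum_eq {α β : List ℕ+} (hα : α.length ≤ 1) (hβ : β.length ≤ 1)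
    (h : (α.map (fun a : ℕ+ => (a : ℕ))).sum = (β.map (fun a : ℕ+ => (a : ℕ))).sum) : α = β := by
  match α, β, hα, hβ with
  | [], [], _, _ => rfl
  | [], [b], _, _ => exact (b.pos.ne (by simpa using h)).elim
  | [a], [], _, _ => simp at h
  | [a], [b], _, _ => simpa using h

/-- Each degree has exactly one composition with at most one part, so on a homogeneous element the
character reads off its coefficient. -/
lemma coord_of_mem_qsymDegree {n : ℕ} {f : QSym K} (hf : f ∈ qsymDegree K n) {α : List ℕ+}
    (hα : α.length ≤ 1) : (qsymBasis K).coord α f =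
      if (α.map (fun a : ℕ+ => (a : ℕ))).sum = n then zetaQSym K f else 0 := by
  induction hf using Submodule.span_induction with
  | mem f hf =>
    obtain ⟨γ, rfl, rfl⟩ := hf
    rw [zetaQSym, Module.Basis.constr_basis, Module.Basis.coord_apply, Module.Basis.repr_self,
      Finsupp.single_apply, ← ite_and]
    congr 1
    rw [eq_iff_iff]
    exact ⟨by rintro rfl; exact ⟨rfl, hα⟩, fun h => eq_of_sum_eq h.2 hα h.1.symm⟩
  | zero => simp
  | add f g _ _ hf hg => rw [map_add, map_add, hf, hg]; split_ifs <;> simp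
  | smul c f _ hf => rw [map_smul, map_smul, hf]; split_ifs <;> simp

lemma mem_qsymDegree {n : ℕ} {f : QSym K}
    (hf : ∀ α, (qsymBasis K).coord α f ≠ 0 → (α.map (fun a : ℕ+ => (a : ℕ))).sum = n) :
    f ∈ qsymDegree K n := by
  rw [← (qsymBasis K).linearCombination_repr f, Finsupp.linearCombination_apply]
  refine Submodule.sum_mem _ fun α hα => Submodule.smul_mem _ _ (Submodule.subset_span ⟨α, ?_, rfl⟩)
  exact hf α (Finsupp.mem_support_iff.1 hα)

/-- The coefficient of M_{αβ} may be read at a monomial whose β-variables all come after its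
α-variables, as `monotoneSum_add` requires. -/
lemma exists_expVec_append (α β : List ℕ+) : ∃ (i : Fin α.length ↪o ℕ+) (j : Fin β.length ↪o ℕ+)
    (k : Fin (α ++ β).length ↪o ℕ+), expVec (α ++ β) k = expVec α i + expVec β j ∧
      ∀ a b, i a < j b := by
  let j : Fin β.length ↪o ℕ+ := OrderEmbedding.ofStrictMono
    (fun b => ⟨α.length + b + 1, Nat.succ_pos _⟩) fun a b h => by
      change α.length + (a : ℕ) + 1 < α.length + b + 1
      simpa using h
  refine ⟨initEmb _, j, initEmb _, ?_, fun a b => ?_⟩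
  · rw [expVec, ← Fintype.sum_equiv (finCongr List.length_append.symm) _ _ fun _ => rfl,
      Fin.sum_univ_add, expVec, expVec]
    congr 1
    · refine Finset.sum_congr rfl fun a _ => ?_
      simp [initEmb]
      rfl
    · refine Finset.sum_congr rfl fun a _ => ?_
      simp [initEmb, j]
      rfl
  · change (a : ℕ) + 1 < α.length + b + 1
    omega

end QSymCoord

/-! ### The enumerator of monotone maps and the universal morphism -/

section Enumerator

variable {K : Type v} [Field K] (q : K)

lemma degree_eq_of_monotoneSum_ne_zero {P : Type u} [PartialOrder P] [Fintype P] {L : Type*}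
    [LinearOrder L] {m : L →₀ ℕ} (h : monotoneSum q P m ≠ 0) : m.degree = Fintype.card P := by
  obtain ⟨f, -, -⟩ := Finset.exists_ne_zero_of_sum_ne_zero h
  rw [← f.2.2, degree_content]

/-- Only the constant map has this content, and its level relation is the whole strict order. -/
lemma monotoneSum_single (P : Type u) [PartialOrder P] [Fintype P] {L : Type*}
    [LinearOrder L] (x : L) :
    monotoneSum q P (Finsupp.single x (Fintype.card P)) = q ^ posetRank P := by
  have h : ∀ f : MonotoneMap P (Finsupp.single x (Fintype.card P)), f.1 = fun _ => x := fun f =>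
    funext fun p => by
      have := Finsupp.support_single_subset (f.mem_support p)
      simpa using this
  have : Unique (MonotoneMap P (Finsupp.single x (Fintype.card P))) :=
    { default := ⟨fun _ => x, monotone_const, by simp [content]⟩
      uniq := fun f => Subtype.ext (h f) }
  rw [monotoneSum, Fintype.sum_unique, h, levelRank, posetRank_eq_relRank]
  simp

/-- The sum of `q ^ levelRank f ∏ x_{f p}` over the monotone maps `f` from `P` to the positive
integers. -/
noncomputable def enumerator (P : Type u) [PartialOrder P] [Fintype P] : MvPowerSeries ℕ+ K :=
  fun m => monotoneSum q P m

lemma coeff_enumerator (P : Type u) [PartialOrder P] [Fintype P] (m : ℕ+ →₀ ℕ) :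
    MvPowerSeries.coeff m (enumerator q P) = monotoneSum q P m := rfl

lemma isQuasisymmetric_enumerator (P : Type u) [PartialOrder P] [Fintype P] :
    IsQuasisymmetric (enumerator q P) :=
  ⟨fun k a i j => by
    rw [coeff_enumerator, coeff_enumerator, monotoneSum_embDomain, monotoneSum_embDomain],
  Fintype.card P, fun _ hm => (degree_eq_of_monotoneSum_ne_zero q hm).le⟩

/-- The quasisymmetric function `enumerator q P`. -/
noncomputable def qsymEnumerator (P : Type u) [PartialOrder P] [Fintype P] : QSym K :=
  ⟨enumerator q P, mem_span_monomialQSym_iff.2 (isQuasisymmetric_enumerator q P)⟩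

lemma coord_qsymEnumerator (P : Type u) [PartialOrder P] [Fintype P] (α : List ℕ+)
    (i : Fin α.length ↪o ℕ+) :
    (qsymBasis K).coord α (qsymEnumerator q P) = monotoneSum q P (expVec α i) :=
  (coeff_expVec _ α i).symm

lemma qsymEnumerator_congr {P Q : Type u} [PartialOrder P] [Fintype P] [PartialOrder Q] [Fintype Q]
    (e : P ≃o Q) : qsymEnumerator q P = qsymEnumerator q Q :=
  Subtype.ext <| funext fun m => monotoneSum_congr q e m

lemma qsymEnumerator_sum (P Q : Type u) [PartialOrder P] [Fintype P] [PartialOrder Q] [Fintype Q] :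
    qsymEnumerator q (P ⊕ Q) = qsymEnumerator q P * qsymEnumerator q Q := by
  classical
  refine Subtype.ext (MvPowerSeries.ext fun m => ?_)
  change MvPowerSeries.coeff m (enumerator q (P ⊕ Q)) =
    MvPowerSeries.coeff m (enumerator q P * enumerator q Q)
  rw [MvPowerSeries.coeff_mul, coeff_enumerator, monotoneSum_sum]
  simp only [coeff_enumerator]

lemma qsymEnumerator_empty (P : Type u) [PartialOrder P] [Fintype P] [IsEmpty P] :
    qsymEnumerator q P = 1 := by
  classical
  refine Subtype.ext (MvPowerSeries.ext fun m => ?_)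
  change monotoneSum q P m = MvPowerSeries.coeff m 1
  rw [MvPowerSeries.coeff_one]
  split_ifs with h
  -- The zero content is x_1^0, so the single-variable formula applies, with rank 0.
  · have := monotoneSum_single q P (1 : ℕ+)
    rw [Fintype.card_eq_zero, Finsupp.single_zero] at this
    rw [h, this, posetRank]
    simp
  · by_contra hne
    have := degree_eq_of_monotoneSum_ne_zero q hne
    rw [Fintype.card_eq_zero, Finsupp.degree_eq_zero_iff] at this
    exact h this

/-- The enumerator as a multiplicative function of the isomorphism class. -/
noncomputable def classEnumerator : PosetClass.{u} →* QSym K where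
  toFun := Quotient.lift (fun P : FinPartOrd.{u} => qsymEnumerator q P)
    fun _ _ ⟨e⟩ => qsymEnumerator_congr q e
  map_one' := qsymEnumerator_empty q PEmpty
  map_mul' := by
    rintro ⟨P⟩ ⟨Q⟩
    exact qsymEnumerator_sum q P Q

/-- The universal morphism as a morphism of algebras. -/
noncomputable def universalAlgHom : PosetAlg.{u} K →ₐ[K] QSym K :=
  (MonoidAlgebra.lift K (QSym K) PosetClass.{u} (classEnumerator q) :
    MonoidAlgebra K PosetClass.{u} →ₐ[K] QSym K)

lemma universalAlgHom_posetElt (P : Type u) [PartialOrder P] [Fintype P] :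
    universalAlgHom q (posetElt K P) = qsymEnumerator q P := by
  refine (MonoidAlgebra.lift_single (classEnumerator q) (cls P) (1 : K)).trans ?_
  rw [one_smul]
  rfl

lemma qsymEnumerator_mem_qsymDegree (P : Type u) [PartialOrder P] [Fintype P] :
    qsymEnumerator q P ∈ qsymDegree K (Fintype.card P) := by
  refine mem_qsymDegree fun α hα => ?_
  rw [coord_qsymEnumerator q P α (initEmb _)] at hα
  rw [← degree_expVec α (initEmb _), degree_eq_of_monotoneSum_ne_zero q hα]

lemma exists_expVec_eq_single (n : ℕ) : ∃ (α : List ℕ+) (i : Fin α.length ↪o ℕ+), α.length ≤ 1 ∧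
    (α.map (fun a : ℕ+ => (a : ℕ))).sum = n ∧ expVec α i = Finsupp.single 1 n := by
  rcases Nat.eq_zero_or_pos n with rfl | hn
  · exact ⟨[], initEmb _, by simp, by simp, by simp [expVec]⟩
  · obtain ⟨a, rfl⟩ : ∃ a : ℕ+, (a : ℕ) = n := ⟨⟨n, hn⟩, rfl⟩
    refine ⟨[a], initEmb _, by simp, by simp, ?_⟩
    change ∑ j : Fin 1, _ = _
    rw [Fin.sum_univ_one]
    rfl

lemma zetaQSym_qsymEnumerator (P : Type u) [PartialOrder P] [Fintype P] :
    zetaQSym K (qsymEnumerator q P) = q ^ posetRank P := by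
  obtain ⟨α, i, hα, hs, he⟩ := exists_expVec_eq_single (Fintype.card P)
  have := coord_of_mem_qsymDegree (qsymEnumerator_mem_qsymDegree q P) hα
  rw [if_pos hs, coord_qsymEnumerator q P α i, he, monotoneSum_single] at this
  exact this.symm

lemma comul_posetElt (P : Type u) [PartialOrder P] [Fintype P] :
    CoalgebraStruct.comul (R := K) (posetElt K P) = comulPoset K P :=
  (posetBasis K).constr_basis K _ (cls P)

lemma cls_eq_one_iff (P : Type u) [PartialOrder P] [Fintype P] : cls P = 1 ↔ IsEmpty P := by
  constructor
  · intro h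
    obtain ⟨e⟩ := Quotient.exact h
    exact ⟨fun p => (e p).elim⟩
  · intro h
    exact cls_eq ⟨Equiv.equivPEmpty P, fun {a} => isEmptyElim a⟩

open Classical in
lemma counit_posetElt (P : Type u) [PartialOrder P] [Fintype P] :
    CoalgebraStruct.counit (R := K) (posetElt K P) = if IsEmpty P then 1 else 0 := by
  refine ((posetBasis K).constr_basis K _ (cls P)).trans ?_
  simp only [cls_eq_one_iff]

lemma zetaPoset_posetElt (P : Type u) [PartialOrder P] [Fintype P] :
    zetaPoset K q (posetElt K P) = q ^ posetRank P :=
  (posetBasis K).constr_basis K _ (cls P)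

lemma posetAlg_hom_ext {M : Type*} [AddCommMonoid M] [Module K M] {f g : PosetAlg.{u} K →ₗ[K] M}
    (h : ∀ P : FinPartOrd.{u}, f (posetElt K P) = g (posetElt K P)) : f = g := by
  refine (posetBasis K).ext fun p => ?_
  induction p using Quotient.inductionOn with
  | h P => exact h P

lemma counit_qsymEnumerator (P : Type u) [PartialOrder P] [Fintype P] :
    CoalgebraStruct.counit (R := K) (qsymEnumerator q P) =
      CoalgebraStruct.counit (R := K) (posetElt K P) := by
  classical
  rw [counit_posetElt]
  split_ifs with h
  · rw [qsymEnumerator_empty, counit_eq_coord, ← coeff_expVec _ [] (initEmb _)]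
    change MvPowerSeries.coeff (expVec [] (initEmb _)) 1 = _
    have : expVec [] (initEmb _) = 0 := by simp [expVec]
    rw [this, MvPowerSeries.coeff_zero_one]
  · rw [counit_eq_coord, coord_qsymEnumerator q P [] (initEmb _)]
    by_contra hne
    have := degree_eq_of_monotoneSum_ne_zero q hne
    rw [degree_expVec] at this
    exact h (Fintype.card_eq_zero_iff.1 this.symm)

/-- The coefficient at M_α ⊗ M_β is a sum over ideals on one side and the coefficient at αβ on the
other; `monotoneSum_add` identifies them. -/
lemma comul_qsymEnumerator (P : Type u) [PartialOrder P] [Fintype P] :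
    TensorProduct.map (universalAlgHom.{u} q).toLinearMap (universalAlgHom q).toLinearMap
      (comulPoset K P) = CoalgebraStruct.comul (R := K) (qsymEnumerator q P) := by
  classical
  refine tensorCoord_ext fun α β => ?_
  obtain ⟨i, j, k, hk, hij⟩ := exists_expVec_append α β
  rw [tensorCoord_comul, coord_qsymEnumerator q P _ k, hk, monotoneSum_add, comulPoset, map_sum,
    map_sum]
  · refine Finset.sum_congr rfl fun S _ => ?_
    rw [TensorProduct.map_tmul, tensorCoord_tmul, AlgHom.toLinearMap_apply,
      AlgHom.toLinearMap_apply, universalAlgHom_posetElt, universalAlgHom_posetElt,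
      coord_qsymEnumerator q _ α i, coord_qsymEnumerator q _ β j]
  · intro a ha b hb
    obtain ⟨x, rfl⟩ := (mem_support_expVec α i a).1 ha
    obtain ⟨y, rfl⟩ := (mem_support_expVec β j b).1 hb
    exact hij x y

/-- The universal morphism. -/
noncomputable def universalHom : PosetAlg.{u} K →ₐc[K] QSym K :=
  { (universalAlgHom.{u} q).toLinearMap, (universalAlgHom.{u} q).toRingHom.toMonoidHom with
    counit_comp := posetAlg_hom_ext fun P => by
      change CoalgebraStruct.counit (universalAlgHom q (posetElt K P)) = _
      rw [universalAlgHom_posetElt]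
      exact counit_qsymEnumerator q P
    map_comp_comul := posetAlg_hom_ext fun P => by
      change TensorProduct.map (universalAlgHom.{u} q).toLinearMap (universalAlgHom q).toLinearMap
        (CoalgebraStruct.comul (posetElt K P)) =
          CoalgebraStruct.comul (universalAlgHom q (posetElt K P))
      rw [universalAlgHom_posetElt, comul_posetElt]
      exact comul_qsymEnumerator q P }

lemma universalHom_posetElt (P : Type u) [PartialOrder P] [Fintype P] :
    universalHom q (posetElt K P) = qsymEnumerator q P :=
  universalAlgHom_posetElt q P

lemma isCombinatorialHopfMorphism_universalHom :
    IsCombinatorialHopfMorphism.{u} q (universalHom q) := by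
  constructor
  · intro n x hx
    induction hx using Submodule.span_induction with
    | mem x hx =>
      obtain ⟨P, rfl, rfl⟩ := hx
      rw [universalHom_posetElt, Nat.card_eq_fintype_card]
      exact qsymEnumerator_mem_qsymDegree q P
    | zero => rw [map_zero]; exact zero_mem _
    | add x y _ _ hx hy => rw [map_add]; exact add_mem hx hy
    | smul c x _ hx => rw [map_smul]; exact Submodule.smul_mem _ _ hx
  · have h : (zetaQSym K).comp (universalAlgHom.{u} q).toLinearMap = zetaPoset K q :=
      posetAlg_hom_ext fun P => by
        rw [zetaPoset_posetElt, LinearMap.comp_apply, AlgHom.toLinearMap_apply,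
          universalAlgHom_posetElt, zetaQSym_qsymEnumerator]
    exact fun x => LinearMap.congr_fun h x

/-! ### Uniqueness of the morphism -/

variable {q}

lemma IsCombinatorialHopfMorphism.coord_singleton {Φ : PosetAlg.{u} K →ₐc[K] QSym K}
    (hΦ : IsCombinatorialHopfMorphism q Φ) (a : ℕ+) (P : FinPartOrd.{u}) :
    (qsymBasis K).coord [a] (Φ (posetElt K P)) = if (a : ℕ) = Nat.card P then
      zetaPoset K q (posetElt K P) else 0 := by
  have h := hΦ.1 (Nat.card P) (posetElt K P) (Submodule.subset_span ⟨P, rfl, rfl⟩)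
  rw [coord_of_mem_qsymDegree h (by simp), hΦ.2]
  simp

/-- A morphism of combinatorial Hopf algebras to quasisymmetric functions is unique. -/
lemma IsCombinatorialHopfMorphism.unique {Φ Ψ : PosetAlg.{u} K →ₐc[K] QSym K}
    (hΦ : IsCombinatorialHopfMorphism q Φ) (hΨ : IsCombinatorialHopfMorphism q Ψ) : Φ = Ψ := by
  have key : ∀ α, ((qsymBasis K).coord α).comp Φ.toCoalgHom.toLinearMap =
      ((qsymBasis K).coord α).comp Ψ.toCoalgHom.toLinearMap := by
    intro α
    induction α with
    | nil => rw [← counit_eq_coord, Φ.counit_comp, Ψ.counit_comp]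
    | cons a β ih =>
      have hs : ((qsymBasis K).coord [a]).comp Φ.toCoalgHom.toLinearMap =
          ((qsymBasis K).coord [a]).comp Ψ.toCoalgHom.toLinearMap :=
        posetAlg_hom_ext fun P =>
          (hΦ.coord_singleton a P).trans (hΨ.coord_singleton a P).symm
      -- Since a :: β = [a] ++ β, compatibility with the coproduct expresses this coordinate through
      -- those at [a] and β.
      have h : ∀ Θ : PosetAlg.{u} K →ₐc[K] QSym K,
          ((qsymBasis K).coord (a :: β)).comp Θ.toCoalgHom.toLinearMap =
          (LinearMap.mul' K K).comp ((TensorProduct.map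
            (((qsymBasis K).coord [a]).comp Θ.toCoalgHom.toLinearMap)
            (((qsymBasis K).coord β).comp Θ.toCoalgHom.toLinearMap)).comp
              (CoalgebraStruct.comul (R := K) (A := PosetAlg.{u} K))) := by
        intro Θ
        rw [TensorProduct.map_comp, LinearMap.comp_assoc, Θ.map_comp_comul]
        ext x
        exact (tensorCoord_comul [a] β (Θ x)).symm
      rw [h, h, hs, ih]
  refine DFunLike.ext _ _ fun x => (qsymBasis K).ext_elem fun α => ?_
  exact LinearMap.congr_fun (key α) x

end Enumerator

/-! ## Flags of ideals and monotone maps -/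

section Flags

variable {P : Type u} [PartialOrder P]

lemma content_apply [Fintype P] {L : Type*} (f : P → L) (x : L) :
    content f x = (f ⁻¹' {x}).ncard := by
  classical
  rw [content, Finsupp.finsetSum_apply, Set.ncard_eq_toFinset_card']
  simp only [Finsupp.single_apply, Finset.sum_boole, Nat.cast_id]
  congr 1
  ext p
  simp

namespace IdealFlag

/-- The ideal `{p | f p < j}`. -/
def below {k : ℕ} (f : P → Fin k) (hf : Monotone f) (j : ℕ) : LowerSet P :=
  ⟨{p | (f p : ℕ) < j}, fun _ _ hab ha => lt_of_le_of_lt (Fin.le_def.1 (hf hab)) ha⟩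

lemma mem_below {k : ℕ} {f : P → Fin k} {hf : Monotone f} {j : ℕ} {p : P} :
    p ∈ below f hf j ↔ (f p : ℕ) < j := Iff.rfl

lemma below_lt_below {k : ℕ} {f : P → Fin k} (hf : Monotone f) (hs : Function.Surjective f)
    (i : Fin k) : below f hf i < below f hf (i + 1) := by
  refine lt_of_le_of_ne (fun p hp => Nat.lt_succ_of_lt hp) fun h => ?_
  obtain ⟨p, rfl⟩ := hs i
  have h1 : p ∈ below f hf (f p) ↔ p ∈ below f hf (f p + 1) := by rw [← h]
  simp [mem_below] at h1

/-- The flag of the ideals `{p | f p < j}`. -/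
def ofMap {k : ℕ} (f : P → Fin k) (hf : Monotone f) (hs : Function.Surjective f) : IdealFlag P :=
  ⟨{ length := k
     toFun := fun j => below f hf j
     step := fun i => below_lt_below hf hs i },
    by ext p; exact iff_of_false (Nat.not_lt_zero _) id,
    by ext p; exact iff_of_true (f p).2 trivial⟩

lemma block_ofMap {k : ℕ} (f : P → Fin k) (hf : Monotone f) (hs : Function.Surjective f)
    (i : Fin k) : block (ofMap f hf hs) (show Fin (ofMap f hf hs).1.length from i) = f ⁻¹' {i} := by
  ext p
  change ((f p : ℕ) < i + 1 ∧ ¬ (f p : ℕ) < i) ↔ f p = i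
  rw [Fin.ext_iff]
  omega

lemma ofMap_injective {k : ℕ} {f g : P → Fin k} {hf : Monotone f} {hs : Function.Surjective f}
    {hg : Monotone g} {ht : Function.Surjective g} (h : ofMap f hf hs = ofMap g hg ht) : f = g := by
  have h1 : (ofMap f hf hs).1 = (ofMap g hg ht).1 := congrArg Subtype.val h
  rw [ofMap, ofMap] at h1
  simp only [RelSeries.mk.injEq, heq_eq_eq, true_and] at h1
  have key : ∀ (j : Fin (k + 1)) p, (f p : ℕ) < j ↔ (g p : ℕ) < j := fun j p =>
    iff_of_eq (congrArg (fun S : LowerSet P => p ∈ S) (congrFun h1 j))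
  funext p
  have a := (key (f p).succ p).1 (by simp)
  have b := (key (g p).succ p).2 (by simp)
  rw [Fin.val_succ] at a b
  exact Fin.ext (by omega)

/-- The blocks partition P; f sends a point to the index of its block, and is monotone because the
members of the flag are lower sets. -/
lemma exists_ofMap_eq (F : IdealFlag P) : ∃ (f : P → Fin F.1.length) (hf : Monotone f)
    (hs : Function.Surjective f), ofMap f hf hs = F := by
  classical
  have hmono : Monotone F.1 := F.1.strictMono.monotone
  have hex : ∀ p : P, ∃ i : Fin F.1.length, p ∈ F.block i := by
    intro p
    have hlast : p ∈ F.1 (Fin.last _) := by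
      have : F.1 (Fin.last _) = ⊤ := F.2.2
      rw [this]; trivial
    have hzero : p ∉ F.1 0 := by
      have : F.1 0 = ⊥ := F.2.1
      rw [this]; exact id
    by_contra! hno
    have : ∀ j : Fin (F.1.length + 1), p ∉ F.1 j := by
      intro j
      induction j using Fin.induction with
      | zero => exact hzero
      | succ i ih => exact fun h => hno i ⟨h, ih⟩
    exact this _ hlast
  choose f hf using hex
  have hlt : ∀ p (j : Fin (F.1.length + 1)), p ∈ F.1 j ↔ (f p : ℕ) < j := by
    intro p j
    constructor
    · intro h
      by_contra! hle
      exact (hf p).2 (hmono (show j ≤ (f p).castSucc from hle) h)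
    · intro h
      exact hmono (show (f p).succ ≤ j from h) (hf p).1
  refine ⟨f, fun a b hab => ?_, fun i => ?_, ?_⟩
  · have := (hlt a _).1 ((F.1 (f b).succ).lower hab (hf b).1)
    rw [Fin.val_succ] at this
    exact Nat.lt_succ_iff.1 this
  · obtain ⟨p, hp⟩ := F.block_nonempty i
    refine ⟨p, Fin.ext ?_⟩
    have h1 := (hlt p _).1 hp.1
    have h2 := mt (hlt p _).2 hp.2
    simp at h1 h2
    omega
  · refine Subtype.ext ?_
    refine RelSeries.ext rfl ?_
    funext j
    ext p
    exact (hlt p j).symm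

variable [Fintype P]

/-- The level relation never joins different fibres, and the fibres are the blocks, so the level
rank is the sum of the block ranks. -/
lemma rank_ofMap {k : ℕ} (f : P → Fin k) (hf : Monotone f) (hs : Function.Surjective f) :
    (ofMap f hf hs).rank = levelRank f := by
  rw [levelRank, relRank_fiber f _ fun _ _ h => h.2, finsum_eq_sum_of_fintype]
  change ∑ i : Fin k, posetRank ((ofMap f hf hs).block i) = _
  refine Finset.sum_congr rfl fun i _ => ?_
  rw [block_ofMap, posetRank_eq_relRank]
  change _ = relRank fun a b : (f ⁻¹' {i} : Set P) => (a : P) < b ∧ f a = f b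
  congr! 3 with a b
  exact ⟨fun h => ⟨h, a.2.trans b.2.symm⟩, fun h => h.1⟩

lemma type_ofMap {k : ℕ} (f : P → Fin k) (hf : Monotone f) (hs : Function.Surjective f) :
    (ofMap f hf hs).type.length = k ∧ (ofMap f hf hs).type.map (fun a : ℕ+ => (a : ℕ)) =
      List.ofFn fun i => content f i := by
  refine ⟨List.length_ofFn, ?_⟩
  refine List.map_ofFn.trans ?_
  change List.ofFn (n := k) _ = _
  congr 1
  funext i
  exact (congrArg Set.ncard (block_ofMap f hf hs i)).trans (content_apply f i).symm

end IdealFlag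

variable [Fintype P] {K : Type v} [Field K] (q : K)

lemma ofFn_expo (β : List ℕ+) : (List.ofFn fun i => expo β i) = β.map (fun a : ℕ+ => (a : ℕ)) := by
  conv_rhs => rw [← List.ofFn_get β, List.map_ofFn]
  rfl

lemma MonotoneMap.surjective {β : List ℕ+} (f : MonotoneMap P (expo β)) :
    Function.Surjective f.1 := fun i => by
  rw [← mem_support_content, f.2.2, Finsupp.mem_support_iff]
  exact (β.get i).ne_zero

lemma sum_flags_of_type (β : List ℕ+) [DecidablePred fun F : IdealFlag P => F.type = β] :
    ∑ F : IdealFlag P with F.type = β, q ^ F.rank = monotoneSum q P (expo β) := by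
  symm
  refine Finset.sum_bij (fun f _ => IdealFlag.ofMap f.1 f.2.1 f.surjective) (fun f _ => ?_)
    (fun f _ g _ h => Subtype.ext (IdealFlag.ofMap_injective h)) (fun F hF => ?_) (fun f _ => ?_)
  · rw [Finset.mem_filter]
    refine ⟨Finset.mem_univ _, List.map_injective_iff.2 PNat.coe_injective ?_⟩
    rw [(IdealFlag.type_ofMap f.1 f.2.1 f.surjective).2, ← ofFn_expo, f.2.2]
  · obtain rfl := (Finset.mem_filter.1 hF).2
    have hl : F.1.length = F.type.length := List.length_ofFn.symm
    obtain ⟨f, hf, hs, h⟩ := F.exists_ofMap_eq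
    obtain ⟨h1, h2⟩ := IdealFlag.type_ofMap f hf hs
    rw [h] at h1 h2
    -- The codomain of f must become `Fin F.type.length`, the index type of `expo F.type`.
    generalize F.1.length = k at f hl
    subst hl
    refine ⟨⟨f, hf, Finsupp.ext fun i => ?_⟩, Finset.mem_univ _, h⟩
    rw [← ofFn_expo] at h2
    exact (congrFun (List.ofFn_injective h2) i).symm
  · rw [IdealFlag.rank_ofMap]

/-- The expansion of the enumerator in monomial quasisymmetric functions. -/
lemma enumerator_eq_sum_flags :
    enumerator q P = ∑ F : IdealFlag P, q ^ F.rank • monomialQSym K F.type := by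
  classical
  refine MvPowerSeries.ext fun m => ?_
  obtain ⟨β, s, rfl⟩ := exists_expVec m
  -- Relabelling the variables by `Fin β.length` gives a content of full support, so the maps
  -- counted are surjective and define flags.
  rw [coeff_enumerator, expVec_eq_embDomain, monotoneSum_embDomain, ← expVec_eq_embDomain,
    ← sum_flags_of_type, map_sum, Finset.sum_filter]
  refine Finset.sum_congr rfl fun F _ => ?_
  rw [map_smul, coeff_monomialQSym, smul_eq_mul, mul_ite, mul_one, mul_zero]

end Flags

/-! ## Faces of finitely generated cones -/

section Geometry

variable {ι : Type u} [Fintype ι]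

/-- The points of `C` at which `⟨w, ·⟩` is maximal. -/
def maximizers (C : Set (ι → ℝ)) (w : ι → ℝ) : Set (ι → ℝ) :=
  {x ∈ C | ∀ y ∈ C, w ⬝ᵥ y ≤ w ⬝ᵥ x}

lemma mem_faces_iff {C : Set (ι → ℝ)} {G : Set (ι → ℝ)} :
    G ∈ faces C ↔ G.Nonempty ∧ ∃ w, G = maximizers C w := by
  classical
  refine and_congr_right fun hG => ⟨fun h => ?_, ?_⟩
  · obtain ⟨l, hl⟩ := h hG
    refine ⟨(dotProductEquiv ℝ ι).symm l.toLinearMap, ?_⟩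
    have : ∀ y, (dotProductEquiv ℝ ι).symm l.toLinearMap ⬝ᵥ y = l y := fun y =>
      LinearMap.congr_fun ((dotProductEquiv ℝ ι).apply_symm_apply l.toLinearMap) y
    rw [hl]
    simp only [maximizers, this]
  · rintro ⟨w, rfl⟩ -
    exact ⟨LinearMap.toContinuousLinearMap (dotProductEquiv ℝ ι w), rfl⟩

/-- The cone generated by a set of vectors. -/
def genCone (V : Set (ι → ℝ)) : Set (ι → ℝ) := (PointedCone.hull ℝ V : PointedCone ℝ (ι → ℝ))

variable {V : Set (ι → ℝ)} {w : ι → ℝ}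

/-- The two claims need a joint induction: a sum of two nonpositive pairings vanishes only if both
do. -/
lemma dotProduct_nonpos_of_mem_genCone (hw : ∀ v ∈ V, w ⬝ᵥ v ≤ 0) {x : ι → ℝ}
    (hx : x ∈ genCone V) : w ⬝ᵥ x ≤ 0 ∧ (w ⬝ᵥ x = 0 → x ∈ genCone {v ∈ V | w ⬝ᵥ v = 0}) := by
  change x ∈ PointedCone.hull ℝ V at hx
  change _ ∧ (_ → x ∈ PointedCone.hull ℝ {v ∈ V | w ⬝ᵥ v = 0})
  induction hx using Submodule.span_induction with
  | mem x hx => exact ⟨hw x hx, fun h => Submodule.subset_span ⟨hx, h⟩⟩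
  | zero => exact ⟨by simp, fun _ => zero_mem _⟩
  | add x y _ _ hx hy =>
    rw [dotProduct_add]
    refine ⟨add_nonpos hx.1 hy.1, fun h => add_mem (hx.2 ?_) (hy.2 ?_)⟩
    · linarith [hx.1, hy.1]
    · linarith [hx.1, hy.1]
  | smul c x _ hx =>
    have hc : w ⬝ᵥ (c • x) = (c : ℝ) * (w ⬝ᵥ x) := dotProduct_smul (c : ℝ) w x
    rw [hc]
    refine ⟨mul_nonpos_of_nonneg_of_nonpos c.2 hx.1, fun h => ?_⟩
    rcases mul_eq_zero.1 h with h | h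
    · have : c = 0 := Subtype.ext h
      rw [this, zero_smul]
      exact zero_mem _
    · exact Submodule.smul_mem _ _ (hx.2 h)

lemma subset_genCone (V : Set (ι → ℝ)) : V ⊆ genCone V := Submodule.subset_span

lemma zero_mem_genCone (V : Set (ι → ℝ)) : (0 : ι → ℝ) ∈ genCone V :=
  zero_mem (PointedCone.hull ℝ V)

lemma genCone_mono {V W : Set (ι → ℝ)} (h : V ⊆ W) : genCone V ⊆ genCone W :=
  Submodule.span_mono h

lemma dotProduct_eq_zero_of_mem_genCone (hw : ∀ v ∈ V, w ⬝ᵥ v = 0) {x : ι → ℝ}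
    (hx : x ∈ genCone V) : w ⬝ᵥ x = 0 := by
  refine le_antisymm (dotProduct_nonpos_of_mem_genCone (fun v hv => (hw v hv).le) hx).1 ?_
  have := (dotProduct_nonpos_of_mem_genCone (w := -w)
    (fun v hv => by rw [neg_dotProduct, hw v hv, neg_zero]) hx).1
  rw [neg_dotProduct] at this
  linarith

lemma maximizers_genCone (hw : ∀ v ∈ V, w ⬝ᵥ v ≤ 0) :
    maximizers (genCone V) w = genCone {v ∈ V | w ⬝ᵥ v = 0} := by
  ext x
  constructor
  · rintro ⟨hx, hmax⟩
    have h := dotProduct_nonpos_of_mem_genCone hw hx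
    have := hmax 0 (zero_mem_genCone V)
    rw [dotProduct_zero] at this
    exact h.2 (le_antisymm h.1 this)
  · intro hx
    refine ⟨genCone_mono (fun v hv => hv.1) hx, fun y hy => ?_⟩
    rw [dotProduct_eq_zero_of_mem_genCone (fun v hv => hv.2) hx]
    exact (dotProduct_nonpos_of_mem_genCone hw hy).1

/-- The cone contains x + v whenever it contains x, so a positive pairing with v would contradict
maximality at x. -/
lemma nonpos_of_mem_maximizers {x : ι → ℝ} (hx : x ∈ maximizers (genCone V) w) :
    ∀ v ∈ V, w ⬝ᵥ v ≤ 0 := by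
  intro v hv
  have := hx.2 (x + v) (add_mem (S := PointedCone ℝ (ι → ℝ)) (s := PointedCone.hull ℝ V) hx.1
    (subset_genCone V hv))
  rw [dotProduct_add] at this
  linarith

/-- A face is the cone over a subset of the finitely many generators. -/
lemma finite_faces_genCone (hV : V.Finite) : (faces (genCone V)).Finite := by
  refine (hV.finite_subsets.image genCone).subset fun G hG => ?_
  obtain ⟨⟨x, hx⟩, w, rfl⟩ := mem_faces_iff.1 hG
  exact ⟨_, fun v hv => hv.1, (maximizers_genCone (nonpos_of_mem_maximizers hx)).symm⟩

lemma mem_normalCone_iff {w₀ : ι → ℝ} (hw₀ : ∀ v ∈ V, w₀ ⬝ᵥ v ≤ 0) :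
    w ∈ normalCone (genCone V) (maximizers (genCone V) w₀) ↔
      (∀ v ∈ V, w ⬝ᵥ v ≤ 0) ∧ ∀ v ∈ V, w₀ ⬝ᵥ v = 0 → w ⬝ᵥ v = 0 := by
  rw [maximizers_genCone hw₀]
  constructor
  · intro h
    have h1 : ∀ v ∈ V, w ⬝ᵥ v ≤ 0 := fun v hv => by
      simpa using h 0 (zero_mem_genCone _) v (subset_genCone V hv)
    refine ⟨h1, fun v hv h0 => le_antisymm (h1 v hv) ?_⟩
    simpa using h v (subset_genCone _ ⟨hv, h0⟩) 0 (zero_mem_genCone V)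
  · rintro ⟨h1, h2⟩ x hx y hy
    rw [dotProduct_eq_zero_of_mem_genCone (fun v hv => h2 v hv.1 hv.2) hx]
    exact (dotProduct_nonpos_of_mem_genCone h1 hy).1

lemma maximizers_eq_iff {w₀ : ι → ℝ} (hw₀ : ∀ v ∈ V, w₀ ⬝ᵥ v ≤ 0) (hw : ∀ v ∈ V, w ⬝ᵥ v ≤ 0) :
    maximizers (genCone V) w = maximizers (genCone V) w₀ ↔
      ∀ v ∈ V, w ⬝ᵥ v = 0 ↔ w₀ ⬝ᵥ v = 0 := by
  constructor
  · intro h v hv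
    have key : ∀ w : ι → ℝ, (∀ v ∈ V, w ⬝ᵥ v ≤ 0) →
        (w ⬝ᵥ v = 0 ↔ v ∈ maximizers (genCone V) w) := by
      intro w hw
      rw [maximizers_genCone hw]
      exact ⟨fun h => subset_genCone _ ⟨hv, h⟩,
        dotProduct_eq_zero_of_mem_genCone fun v hv => hv.2⟩
    rw [key w hw, key w₀ hw₀, h]
  · intro h
    rw [maximizers_genCone hw, maximizers_genCone hw₀]
    congr 1
    ext v
    exact and_congr_right fun hv => h v hv

/-- The relative interior of the normal cone at a face `G` of a finitely generated cone consists
of the functionals which are maximized exactly at `G`. -/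
lemma mem_intrinsicInterior_normalCone_iff (hV : V.Finite) {G : Set (ι → ℝ)}
    (hG : G ∈ faces (genCone V)) :
    w ∈ intrinsicInterior ℝ (normalCone (genCone V) G) ↔ maximizers (genCone V) w = G := by
  obtain ⟨⟨x, hx⟩, w₀, rfl⟩ := mem_faces_iff.1 hG
  have hw₀ := nonpos_of_mem_maximizers hx
  have hN := fun w => mem_normalCone_iff (w := w) hw₀
  set N := normalCone (genCone V) (maximizers (genCone V) w₀)
  have h0N : w₀ ∈ N := (hN w₀).2 ⟨hw₀, fun v _ h => h⟩
  rw [mem_intrinsicInterior]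
  constructor
  · rintro ⟨y, hy, rfl⟩
    have hyN : y ∈ ((↑) ⁻¹' N : Set (affineSpan ℝ N)) := interior_subset hy
    change (y : ι → ℝ) ∈ N at hyN
    rw [maximizers_eq_iff hw₀ ((hN _).1 hyN).1]
    refine fun v hv => ⟨fun h0 => ?_, ((hN _).1 hyN).2 v hv⟩
    -- The line from y (t = 0) to w₀ (t = 1) stays in N for some t < 0, as y is relatively interior.
    -- Because y pairs to zero with v, the pairing along the line is t(w₀ · v), and its
    -- nonpositivity at such a t forces w₀ · v ≥ 0.
    let c : ℝ → affineSpan ℝ N := fun t =>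
      ⟨AffineMap.lineMap (y : ι → ℝ) w₀ t,
        AffineMap.lineMap_mem t y.2 (subset_affineSpan ℝ N h0N)⟩
    have hc : Continuous c := by
      refine Continuous.subtype_mk ?_ _
      exact AffineMap.lineMap_continuous
    have hc0 : c 0 = y := Subtype.ext (AffineMap.lineMap_apply_zero _ _)
    have hev : ∀ᶠ t in nhds (0 : ℝ), c t ∈ ((↑) ⁻¹' N : Set (affineSpan ℝ N)) := by
      have : interior ((↑) ⁻¹' N : Set (affineSpan ℝ N)) ∈ nhds (c 0) := by
        rw [hc0]; exact isOpen_interior.mem_nhds hy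
      exact (hc.continuousAt.eventually this).mono fun t ht => interior_subset ht
    obtain ⟨t, htN, ht⟩ := ((hev.filter_mono nhdsWithin_le_nhds).and
      (self_mem_nhdsWithin (a := (0 : ℝ)) (s := Set.Iio 0))).exists
    have h1 := ((hN _).1 htN).1 v hv
    have h2 : ((c t : affineSpan ℝ N) : ι → ℝ) ⬝ᵥ v = t * (w₀ ⬝ᵥ v) := by
      change (AffineMap.lineMap (y : ι → ℝ) w₀ t) ⬝ᵥ v = _
      rw [AffineMap.lineMap_apply_module, add_dotProduct, smul_dotProduct, smul_dotProduct, h0]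
      simp
    rw [h2] at h1
    have ht' : t < 0 := ht
    refine le_antisymm (hw₀ v hv) ?_
    by_contra! hneg
    nlinarith [mul_pos_of_neg_of_neg ht' hneg]
  · intro h
    have hx' : x ∈ maximizers (genCone V) w := h ▸ hx
    have hw := nonpos_of_mem_maximizers hx'
    rw [maximizers_eq_iff hw₀ hw] at h
    have hwN : w ∈ N := (hN w).2 ⟨hw, fun v hv h0 => (h v hv).2 h0⟩
    refine ⟨⟨w, subset_affineSpan ℝ N hwN⟩, ?_, rfl⟩
    have hcont : ∀ v : ι → ℝ, Continuous fun y : affineSpan ℝ N => (y : ι → ℝ) ⬝ᵥ v := fun v =>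
      Continuous.dotProduct continuous_subtype_val continuous_const
    -- The equations defining N are linear, so they persist on the affine span. Only the finitely
    -- many inequalities strict at w remain, and these are open conditions.
    have hzero : ∀ y ∈ affineSpan ℝ N, ∀ v ∈ V, w₀ ⬝ᵥ v = 0 → y ⬝ᵥ v = 0 := by
      intro y hy v hv h0
      refine affineSpan_induction (p := fun y => y ⬝ᵥ v = 0) hy
        (fun y hy => ((hN y).1 hy).2 v hv h0) fun c a b d ha hb hd => ?_
      rw [vadd_eq_add, vsub_eq_sub, add_dotProduct, smul_dotProduct, sub_dotProduct, ha, hb, hd]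
      simp
    rw [mem_interior_iff_mem_nhds]
    have hev : ∀ v ∈ {v ∈ V | w₀ ⬝ᵥ v ≠ 0}, ∀ᶠ y : affineSpan ℝ N in
        nhds ⟨w, subset_affineSpan ℝ N hwN⟩, (y : ι → ℝ) ⬝ᵥ v < 0 := fun v hv =>
      (hcont v).continuousAt.eventually_lt continuousAt_const
        (lt_of_le_of_ne (hw v hv.1) fun h0 => hv.2 ((h v hv.1).1 h0))
    filter_upwards [((hV.subset (Set.sep_subset V _)).eventually_all).2 hev] with y hy
    refine (hN y).2 ⟨fun v hv => ?_, hzero y y.2⟩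
    by_cases h0 : w₀ ⬝ᵥ v = 0
    · exact (hzero y y.2 v hv h0).le
    · exact (hy v ⟨hv, h0⟩).le

lemma finrank_vectorSpan_genCone (V : Set (ι → ℝ)) :
    Module.finrank ℝ (vectorSpan ℝ (genCone V)) = Module.finrank ℝ (Submodule.span ℝ V) := by
  have : vectorSpan ℝ (genCone V) = Submodule.span ℝ V := by
    refine le_antisymm ?_ (Submodule.span_le.2 fun v hv => ?_)
    · rw [vectorSpan_def, Submodule.span_le]
      have h : genCone V ⊆ Submodule.span ℝ V := fun x hx =>
        Submodule.span_le_restrictScalars NNReal ℝ V hx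
      rintro _ ⟨a, ha, b, hb, rfl⟩
      exact sub_mem (h ha) (h hb)
    · simpa using vsub_mem_vectorSpan ℝ (subset_genCone V hv) (zero_mem_genCone V)
  rw [this]

end Geometry

/-! ## The enumerator of a poset cone -/

section PosetCone

variable {P : Type u} [PartialOrder P] [Fintype P] {K : Type v} [Field K] (q : K)

open Classical in
/-- The generators `e_i - e_j`, `i < j`, of the poset cone. -/
def coneGenerators (P : Type u) [PartialOrder P] : Set (P → ℝ) :=
  {x | ∃ i j : P, i < j ∧ x = Pi.single i 1 - Pi.single j 1}

lemma posetCone_eq : posetCone P = genCone (coneGenerators P) := rfl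

lemma finite_coneGenerators : (coneGenerators P).Finite := by
  classical
  refine (Set.finite_range fun p : P × P => (Pi.single p.1 1 - Pi.single p.2 1 : P → ℝ)).subset ?_
  rintro _ ⟨i, j, -, rfl⟩
  exact ⟨(i, j), by congr!⟩

lemma finite_faces_posetCone : (faces (posetCone P)).Finite :=
  finite_faces_genCone finite_coneGenerators

lemma dotProduct_generator [DecidableEq P] (w : P → ℝ) (i j : P) :
    w ⬝ᵥ (Pi.single i 1 - Pi.single j 1) = w i - w j := by
  simp [dotProduct_sub]

/-- The real vector with given positive integer coordinates. -/
def realVec (ω : P → ℕ+) : P → ℝ := fun i => ((ω i : ℕ) : ℝ)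

lemma nonpos_generators_iff (ω : P → ℕ+) :
    (∀ v ∈ coneGenerators P, realVec ω ⬝ᵥ v ≤ 0) ↔ Monotone ω := by
  classical
  constructor
  · intro h i j hij
    rcases hij.eq_or_lt with rfl | hij
    · exact le_rfl
    · have := h _ ⟨i, j, hij, rfl⟩
      rw [dotProduct_generator, sub_nonpos] at this
      exact Nat.cast_le.1 this
  · rintro h _ ⟨i, j, hij, rfl⟩
    rw [dotProduct_generator, sub_nonpos]
    have := h hij.le
    exact Nat.cast_le.2 this

/-- The generators on which ω vanishes are the e_i - e_j with i < j on a common level, so the face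
spans the space defining `levelRank`. -/
lemma finrank_maximizers {ω : P → ℕ+} (hω : Monotone ω) :
    Module.finrank ℝ (vectorSpan ℝ (maximizers (posetCone P) (realVec ω))) = levelRank ω := by
  classical
  rw [posetCone_eq, maximizers_genCone ((nonpos_generators_iff ω).2 hω),
    finrank_vectorSpan_genCone, levelRank, relRank, relSpan]
  suffices h : {v | v ∈ coneGenerators P ∧ realVec ω ⬝ᵥ v = 0} =
      {x | ∃ i j, (i < j ∧ ω i = ω j) ∧ x = Pi.single i 1 - Pi.single j 1} by rw [h]
  ext v
  constructor
  · rintro ⟨⟨i, j, hij, rfl⟩, h0⟩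
    rw [dotProduct_generator, sub_eq_zero] at h0
    exact ⟨i, j, ⟨hij, by exact_mod_cast Nat.cast_injective h0⟩, rfl⟩
  · rintro ⟨i, j, ⟨hij, h0⟩, rfl⟩
    refine ⟨⟨i, j, hij, rfl⟩, ?_⟩
    rw [dotProduct_generator, realVec, realVec, h0, sub_self]

/-- The weighted enumerator of a poset cone is the enumerator of monotone maps. -/
lemma weightedEnumerator_posetCone : weightedEnumerator q (posetCone P) = enumerator q P := by
  classical
  have hfin := finite_faces_posetCone (P := P)
  refine MvPowerSeries.ext fun m => ?_
  rw [weightedEnumerator, finsum_mem_eq_finite_toFinset_sum _ hfin, map_sum, coeff_enumerator,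
    monotoneSum]
  have hface : ∀ f : MonotoneMap P m,
      maximizers (posetCone P) (realVec f.1) ∈ hfin.toFinset := by
    intro f
    rw [Set.Finite.mem_toFinset, mem_faces_iff]
    refine ⟨⟨0, ?_⟩, _, rfl⟩
    rw [posetCone_eq, maximizers_genCone ((nonpos_generators_iff f.1).2 f.2.1)]
    exact zero_mem_genCone _
  -- Monotone maps are grouped by the face on which they are maximal; on each group the weight is
  -- the constant q^(dim G).
  rw [← Finset.sum_fiberwise_of_maps_to (s := Finset.univ) (fun f _ => hface f)]
  refine Finset.sum_congr rfl fun G hG => ?_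
  rw [Set.Finite.mem_toFinset] at hG
  have hint : ∀ ω : P → ℕ+, (fun i => ((ω i : ℕ) : ℝ)) ∈
      intrinsicInterior ℝ (normalCone (posetCone P) G) ↔
        maximizers (posetCone P) (realVec ω) = G := fun ω =>
    mem_intrinsicInterior_normalCone_iff finite_coneGenerators hG
  have hmon : ∀ ω : P → ℕ+, maximizers (posetCone P) (realVec ω) = G → Monotone ω := by
    intro ω h
    obtain ⟨x, hx⟩ := hG.1
    rw [← h] at hx
    exact (nonpos_generators_iff ω).1 (nonpos_of_mem_maximizers hx)
  have hsum : ∑ f : MonotoneMap P m with maximizers (posetCone P) (realVec f.1) = G,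
      q ^ levelRank f.1 = ∑ f : MonotoneMap P m with maximizers (posetCone P) (realVec f.1) = G,
      q ^ Module.finrank ℝ (vectorSpan ℝ G) := by
    refine Finset.sum_congr rfl fun f hf => ?_
    rw [← (Finset.mem_filter.1 hf).2, finrank_maximizers f.2.1]
  rw [hsum, Finset.sum_const, nsmul_eq_mul, mul_comm, faceEnumerator, map_smul, smul_eq_mul]
  congr 1
  change ((Nat.card {a : {ω : P → ℕ+ // (fun i => ((ω i : ℕ) : ℝ)) ∈
      intrinsicInterior ℝ (normalCone (posetCone P) G)} //
      (∑ i, Finsupp.single (a.1 i) 1 : ℕ+ →₀ ℕ) = m} : ℕ) : K) = _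
  congr 1
  rw [← Fintype.card_subtype, ← Nat.card_eq_fintype_card]
  exact Nat.card_congr
    { toFun := fun a => ⟨⟨a.1.1, hmon _ ((hint _).1 a.1.2), a.2⟩, (hint _).1 a.1.2⟩
      invFun := fun f => ⟨⟨f.1.1, (hint _).2 f.2⟩, f.1.2.2⟩
      left_inv := fun _ => rfl
      right_inv := fun _ => rfl }

end PosetCone

end PosetQSym

theorem theorem4p1 (k : Type v) [Field k] :
    ∃ Ψ : PosetAlg.{u} (RatFunc k) →ₐc[RatFunc k] QSym (RatFunc k),
      IsCombinatorialHopfMorphism (RatFunc.X : RatFunc k) Ψ ∧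
      (∀ Φ : PosetAlg.{u} (RatFunc k) →ₐc[RatFunc k] QSym (RatFunc k),
        IsCombinatorialHopfMorphism (RatFunc.X : RatFunc k) Φ → Φ = Ψ) ∧
      ∀ (P : Type u) [PartialOrder P] [Fintype P],
        (faces (posetCone P)).Finite ∧
        weightedEnumerator (RatFunc.X : RatFunc k) (posetCone P) =
          (Ψ (posetElt (RatFunc k) P) : MvPowerSeries ℕ+ (RatFunc k)) ∧
        weightedEnumerator (RatFunc.X : RatFunc k) (posetCone P) =
          ∑ F : IdealFlag P,
            (RatFunc.X : RatFunc k) ^ F.rank • monomialQSym (RatFunc k) F.type := by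
  refine ⟨universalHom RatFunc.X, isCombinatorialHopfMorphism_universalHom _,
    fun Φ hΦ => hΦ.unique (isCombinatorialHopfMorphism_universalHom _), fun P _ _ =>
    ⟨finite_faces_posetCone, ?_, ?_⟩⟩
  · rw [weightedEnumerator_posetCone, universalHom_posetElt]
    rfl
  · rw [weightedEnumerator_posetCone, enumerator_eq_sum_flags]
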